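/- Let $\Delta$ be a metrizable Choquet simplex, i.e. a metrizable compact convex subset of a locally convex Hausdorff real topological vector space such that the cone with base $\Delta$ is a lattice in its own order. Let $\partial_e(\Delta)$ be the set of extreme points of $\Delta$ (its extremal boundary) and put $bd(\partial_e(\Delta))=\overline{\partial_e(\Delta)}\setminus\partial_e(\Delta)$. Every $t\in\Delta$ has a unique boundary measure $\mu_t$, that is, a unique Borel probability measure concentrated on $\partial_e(\Delta)$ with $f(t)=\int f\,d\mu_t$ for every continuous affine function $f:\Delta\to\mathbb R$. For a compact subset $K\subset\partial_e(\Delta)$ let $M_K=\{t\in\Delta:\mu_t(\partial_e(\Delta)\setminus K)=0\}$. One says that $\partial_e(\Delta)$ is tight (has property (T2)) if for every $\varepsilon>0$ there is a compact subset $K\subset\partial_e(\Delta)$ with $\mu_t(K)>1-\varepsilon$ for all $t\in bd(\partial_e(\Delta))$, and that it has property (T1) if there is a compact subset $K\subset\partial_e(\Delta)$ with $bd(\partial_e(\Delta))\subset\overline{\mathrm{conv}(K)}$. Then: (1) If $\partial_e(\Delta)$ is tight, then $\partial_e(\Delta)$ is $\sigma$-compact. (2) If $K\subset\partial_e(\Delta)$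 is compact, then $\overline{\mathrm{conv}(K)}=M_K$. (3) If there is a compact subset $K\subset\partial_e(\Delta)$ such that $bd(\partial_e(\Delta))\setminus\overline{\mathrm{conv}(K)}$ is finite, then $\partial_e(\Delta)$ is tight. In particular, if $bd(\partial_e(\Delta))$ is finite, then $\partial_e(\Delta)$ is tight. (4) If $\partial_e(\Delta)$ has property (T1), then it is tight. -/

import Mathlib

open MeasureTheory

section ChoquetSimplex

variable {E : Type*} [AddCommGroup E] [Module ℝ E]

/-- The cone `{(r • x, r) : r ≥ 0, x ∈ Δ}` in `E × ℝ` over `Δ`; the copy `Δ × {1}` of `Δ` is a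
base of it. -/
def coneOver (Δ : Set E) : Set (E × ℝ) :=
  {p | ∃ r : ℝ, 0 ≤ r ∧ ∃ x ∈ Δ, p = (r • x, r)}

/-- The vector preorder on `E × ℝ` whose positive elements are those of `coneOver Δ`. -/
def ConeLE (Δ : Set E) (u v : E × ℝ) : Prop :=
  v - u ∈ coneOver Δ

/-- A (metrizable) Choquet simplex in a topological vector space: a compact convex metrizable set
which is a base of a lattice cone, i.e. any two elements of the cone over it have a least upper
bound for the order given by the cone.  (Suprema of pairs in the cone give suprema and infima of
all pairs in the vector space generated by the cone, by translation and negation.) -/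
structure IsChoquetSimplex [TopologicalSpace E] (Δ : Set E) : Prop where
  isCompact : IsCompact Δ
  convex : Convex ℝ Δ
  metrizable : TopologicalSpace.MetrizableSpace Δ
  exists_sup : ∀ u ∈ coneOver Δ, ∀ v ∈ coneOver Δ, ∃ w,
    ConeLE Δ u w ∧ ConeLE Δ v w ∧ ∀ z, ConeLE Δ u z → ConeLE Δ v z → ConeLE Δ w z

/-- `f` restricted to the convex set `Δ` is a continuous real affine function on `Δ`; the values
of `f` outside `Δ` are irrelevant. -/
structure IsAffOn [TopologicalSpace E] (Δ : Set E) (f : E → ℝ) : Prop where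
  continuousOn : ContinuousOn f Δ
  map_combo : ∀ x ∈ Δ, ∀ y ∈ Δ, ∀ a b : ℝ, 0 ≤ a → 0 ≤ b → a + b = 1 →
    f (a • x + b • y) = a * f x + b * f y

/-- `bd(∂ₑΔ)`: the points of the closure of the extremal boundary that are not extreme. -/
def bdExtreme [TopologicalSpace E] (Δ : Set E) : Set E :=
  closure (Δ.extremePoints ℝ) \ Δ.extremePoints ℝ

/-- `μ` is a boundary measure of `t`: a Borel probability measure, concentrated on the extremal
boundary of `Δ`, whose barycenter is `t`. -/
structure IsBoundaryMeasure [TopologicalSpace E] [MeasurableSpace E] (Δ : Set E) (t : E)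
    (μ : Measure E) : Prop where
  isProbabilityMeasure : IsProbabilityMeasure μ
  concentrated : μ (Δ.extremePoints ℝ)ᶜ = 0
  barycenter : ∀ f : E → ℝ, IsAffOn Δ f → ∫ x, f x ∂μ = f t

open Classical in
/-- The boundary measure `μ_t` of the point `t` of `Δ`.  The value `0` is taken only where no
boundary measure exists, which never happens for a point of a Choquet simplex. -/
noncomputable def boundaryMeasure [TopologicalSpace E] [MeasurableSpace E] (Δ : Set E) (t : E) :
    Measure E :=
  if h : ∃ μ : Measure E, IsBoundaryMeasure Δ t μ then h.choose else 0

/-- `M_S`: the points of `Δ` whose boundary measure is concentrated on `S ⊆ ∂ₑΔ`. -/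
def concentratedPoints [TopologicalSpace E] [MeasurableSpace E] (Δ S : Set E) : Set E :=
  {t | t ∈ Δ ∧ boundaryMeasure Δ t (Δ.extremePoints ℝ \ S) = 0}

/-- Property (T1) of the extremal boundary of `Δ`. -/
def HasT1 [TopologicalSpace E] (Δ : Set E) : Prop :=
  ∃ K ⊆ Δ.extremePoints ℝ, IsCompact K ∧ bdExtreme Δ ⊆ closure (convexHull ℝ K)

/-- Tightness of the extremal boundary of `Δ`, also called property (T2). -/
def HasTightBoundary [TopologicalSpace E] [MeasurableSpace E] (Δ : Set E) : Prop :=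
  ∀ ε : ℝ, 0 < ε → ∃ K ⊆ Δ.extremePoints ℝ, IsCompact K ∧
    ∀ t ∈ bdExtreme Δ, 1 - ε < (boundaryMeasure Δ t).real K

end ChoquetSimplex

/-! The whole argument takes place on the compact metrizable space `Δ` and its space `A(Δ)` of
continuous affine functions.

Existence of boundary measures is Choquet's theorem.  For `t` in the closed convex hull of a compact
set `K`, the upper envelope `g ↦ inf {h t | h ∈ A(Δ), h ≥ g on K}` is a sublinear functional on
`C(Δ, ℝ)`; by the Hahn–Banach and Riesz–Markov–Kakutani theorems any prescribed `f` is integrated to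
its upper envelope by some probability measure on `K` with barycenter `t`
(`exists_measure_integral_eq_upperEnvelope`).  With `K = Δ` and `f` strictly convex this measure is
concentrated on the extreme points (`exists_represents_extremeSet`); with `t` extreme it is the
point mass, so that `f` agrees with its upper envelope at extreme points.

Uniqueness uses the lattice hypothesis only through the Riesz refinement property of the cone
(`exists_refinement`).  Let `μ`, `ν` have barycenter `t`, let `f` be a maximum of affine functions
`aᵢ` and let `g ≥ f` be a minimum of affine functions `bⱼ`.  Cut `ν` where `f = aᵢ` and `μ` where
`g = bⱼ`, replace each piece by its barycenter in the cone, and refine the two resulting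
decompositions of `t`: since `aᵢ ≤ bⱼ` on each common piece, `∫ f dν ≤ ∫ g dμ`
(`integral_le_integral_of_piecewise`).  If `μ` lives on the extreme points, `g` can be chosen with
`∫ g dμ` arbitrarily close to `∫ f dμ` (`exists_finset_affine_ge`).  By symmetry two boundary
measures of `t` agree on maxima of affine functions, whose differences are dense by the
Stone–Weierstrass theorem.

The points of the closed convex hull of a compact set `K` of extreme points are the barycenters of
the probability measures on `K`, and by uniqueness those are the boundary measures concentrated on
`K`.  So all boundary measures of points of this hull have full mass on `K`, and tightness needs
inner regularity only at the finitely many boundary points (non-extreme limits of extreme points)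
outside the hull; property (T1) is the
case where there are none.  Conversely, if `K` has mass more than `1 / 2` for all boundary points,
the compact set of midpoints of `Δ` and the closed convex hull of `K` contains all boundary points
but no extreme point outside `K`.  The extreme points outside `K` are then a difference of two
compact sets, which is σ-compact by metrizability. -/

namespace ChoquetSimplex

/-! ### Upper envelopes and representing measures -/

section Envelope

variable {X : Type*} [TopologicalSpace X]

/-- The upper envelope of `g` over `K` at `t`: the infimum of the values at `t` of the functions
of `A` that dominate `g` on `K`. -/
noncomputable def upperEnvelope (A : Submodule ℝ C(X, ℝ)) (K : Set X) (t : X) (g : C(X, ℝ)) : ℝ :=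
  sInf ((fun h : C(X, ℝ) => h t) '' {h | h ∈ A ∧ ∀ x ∈ K, g x ≤ h x})

variable {A : Submodule ℝ C(X, ℝ)} {K : Set X} {t : X}

theorem const_mem_of_one_mem (h1 : (1 : C(X, ℝ)) ∈ A) (c : ℝ) :
    (ContinuousMap.const X c) ∈ A := by
  have : ContinuousMap.const X c = c • (1 : C(X, ℝ)) := by ext; simp
  rw [this]; exact A.smul_mem c h1

theorem le_of_forall_le (ht : ∀ h ∈ A, (∀ x ∈ K, 0 ≤ h x) → 0 ≤ h t) {a b : C(X, ℝ)}
    (ha : a ∈ A) (hb : b ∈ A) (hab : ∀ x ∈ K, a x ≤ b x) : a t ≤ b t := by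
  have := ht (b - a) (A.sub_mem hb ha) (fun x hx => by simpa using hab x hx)
  simpa using this

variable [CompactSpace X]

theorem upperEnvelope_set_nonempty (h1 : (1 : C(X, ℝ)) ∈ A) (g : C(X, ℝ)) :
    ((fun h : C(X, ℝ) => h t) '' {h | h ∈ A ∧ ∀ x ∈ K, g x ≤ h x}).Nonempty :=
  ⟨_, ContinuousMap.const X ‖g‖, ⟨const_mem_of_one_mem h1 _,
    fun x _ => (le_abs_self _).trans (g.norm_coe_le_norm x)⟩, rfl⟩

theorem upperEnvelope_set_bddBelow (h1 : (1 : C(X, ℝ)) ∈ A)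
    (ht : ∀ h ∈ A, (∀ x ∈ K, 0 ≤ h x) → 0 ≤ h t) (g : C(X, ℝ)) :
    BddBelow ((fun h : C(X, ℝ) => h t) '' {h | h ∈ A ∧ ∀ x ∈ K, g x ≤ h x}) := by
  refine ⟨-‖g‖, ?_⟩
  rintro _ ⟨h, ⟨hA, hg⟩, rfl⟩
  exact le_of_forall_le ht (const_mem_of_one_mem h1 (-‖g‖)) hA fun x hx =>
    (neg_le_of_abs_le (g.norm_coe_le_norm x)).trans (hg x hx)

theorem upperEnvelope_le (h1 : (1 : C(X, ℝ)) ∈ A)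
    (ht : ∀ h ∈ A, (∀ x ∈ K, 0 ≤ h x) → 0 ≤ h t) {g h : C(X, ℝ)} (hA : h ∈ A)
    (hg : ∀ x ∈ K, g x ≤ h x) : upperEnvelope A K t g ≤ h t :=
  csInf_le (upperEnvelope_set_bddBelow h1 ht g) ⟨h, ⟨hA, hg⟩, rfl⟩

theorem exists_lt_upperEnvelope_add (h1 : (1 : C(X, ℝ)) ∈ A) (g : C(X, ℝ)) {ε : ℝ} (hε : 0 < ε) :
    ∃ h ∈ A, (∀ x ∈ K, g x ≤ h x) ∧ h t < upperEnvelope A K t g + ε := by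
  obtain ⟨_, ⟨h, ⟨hA, hg⟩, rfl⟩, hlt⟩ :=
    Real.lt_sInf_add_pos (upperEnvelope_set_nonempty (K := K) (t := t) h1 g) hε
  exact ⟨h, hA, hg, hlt⟩

theorem upperEnvelope_add_le (h1 : (1 : C(X, ℝ)) ∈ A)
    (ht : ∀ h ∈ A, (∀ x ∈ K, 0 ≤ h x) → 0 ≤ h t) (f g : C(X, ℝ)) :
    upperEnvelope A K t (f + g) ≤ upperEnvelope A K t f + upperEnvelope A K t g := by
  refine le_of_forall_pos_le_add fun ε hε => ?_
  obtain ⟨a, haA, ha, ha'⟩ := exists_lt_upperEnvelope_add (K := K) (t := t) h1 f (half_pos hε)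
  obtain ⟨b, hbA, hb, hb'⟩ := exists_lt_upperEnvelope_add (K := K) (t := t) h1 g (half_pos hε)
  have := upperEnvelope_le h1 ht (g := f + g) (A.add_mem haA hbA) fun x hx => by
    simpa using add_le_add (ha x hx) (hb x hx)
  simp only [ContinuousMap.add_apply] at this
  linarith

theorem upperEnvelope_smul_le (h1 : (1 : C(X, ℝ)) ∈ A)
    (ht : ∀ h ∈ A, (∀ x ∈ K, 0 ≤ h x) → 0 ≤ h t) {c : ℝ} (hc : 0 < c) (g : C(X, ℝ)) :
    upperEnvelope A K t (c • g) ≤ c * upperEnvelope A K t g := by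
  refine le_of_forall_pos_le_add fun ε hε => ?_
  obtain ⟨a, haA, ha, ha'⟩ :=
    exists_lt_upperEnvelope_add (K := K) (t := t) h1 g (div_pos hε hc)
  have := upperEnvelope_le h1 ht (g := c • g) (A.smul_mem c haA) fun x hx => by
    simpa using mul_le_mul_of_nonneg_left (ha x hx) hc.le
  have h2 : c * a t < c * (upperEnvelope A K t g + ε / c) := mul_lt_mul_of_pos_left ha' hc
  rw [mul_add, mul_div_cancel₀ _ hc.ne'] at h2
  simp only [ContinuousMap.smul_apply, smul_eq_mul] at this
  linarith

theorem upperEnvelope_smul (h1 : (1 : C(X, ℝ)) ∈ A)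
    (ht : ∀ h ∈ A, (∀ x ∈ K, 0 ≤ h x) → 0 ≤ h t) {c : ℝ} (hc : 0 < c) (g : C(X, ℝ)) :
    upperEnvelope A K t (c • g) = c * upperEnvelope A K t g := by
  refine le_antisymm (upperEnvelope_smul_le h1 ht hc g) ?_
  have := upperEnvelope_smul_le h1 ht (inv_pos.2 hc) (c • g)
  rw [smul_smul, inv_mul_cancel₀ hc.ne', one_smul] at this
  calc c * upperEnvelope A K t g ≤ c * (c⁻¹ * upperEnvelope A K t (c • g)) :=
        mul_le_mul_of_nonneg_left this hc.le
    _ = _ := by rw [← mul_assoc, mul_inv_cancel₀ hc.ne', one_mul]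

/-- Hahn–Banach for the upper envelope, which is a sublinear functional of `g`. -/
theorem exists_linearMap_le_upperEnvelope (h1 : (1 : C(X, ℝ)) ∈ A)
    (ht : ∀ h ∈ A, (∀ x ∈ K, 0 ≤ h x) → 0 ≤ h t) {f : C(X, ℝ)} (hf : f ≠ 0) :
    ∃ L : C(X, ℝ) →ₗ[ℝ] ℝ, L f = upperEnvelope A K t f ∧ ∀ g, L g ≤ upperEnvelope A K t g := by
  set p := upperEnvelope A K t with hp
  have p0 : p 0 = 0 := by
    have := upperEnvelope_smul h1 ht (c := 2) two_pos (0 : C(X, ℝ))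
    rw [smul_zero] at this
    linarith
  obtain ⟨L, hL, hLp⟩ := exists_extension_of_le_sublinear
    (LinearPMap.mkSpanSingleton (σ := RingHom.id ℝ) f (p f) hf) p
    (fun c hc g => upperEnvelope_smul h1 ht hc g) (upperEnvelope_add_le h1 ht) (by
      rintro ⟨x, hx⟩
      obtain ⟨c, rfl⟩ := Submodule.mem_span_singleton.1 hx
      have : (LinearPMap.mkSpanSingleton (σ := RingHom.id ℝ) f (p f) hf) ⟨c • f, hx⟩ = c • p f :=
        LinearPMap.mkSpanSingleton'_apply _ _ _ _ _
      rw [this, smul_eq_mul]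
      rcases lt_trichotomy c 0 with hc | rfl | hc
      · have h2 := upperEnvelope_smul h1 ht (neg_pos.2 hc) f
        have h3 := upperEnvelope_add_le h1 ht (c • f) (-c • f)
        have h4 : c • f + -c • f = 0 := by rw [← add_smul]; simp
        rw [h4] at h3
        simp only [← hp] at h2 h3 ⊢
        rw [h2, p0] at h3
        linarith
      · simp [p0]
      · exact (upperEnvelope_smul h1 ht hc f).ge)
  refine ⟨L, ?_, hLp⟩
  have := hL ⟨f, Submodule.mem_span_singleton_self f⟩
  rw [this]
  exact LinearPMap.mkSpanSingleton_apply ℝ ℝ hf (p f)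

variable [MeasurableSpace X] [BorelSpace X]

theorem integrable_continuousMap (ν : Measure X) [IsFiniteMeasure ν] (f : C(X, ℝ)) :
    Integrable (fun x => f x) ν :=
  f.continuous.integrable_of_hasCompactSupport (HasCompactSupport.of_compactSpace _)

/-- The Riesz–Markov–Kakutani theorem on a compact space, for continuous maps. -/
theorem exists_measure_of_nonneg [T2Space X] (L : C(X, ℝ) →ₗ[ℝ] ℝ) (hL : ∀ g, 0 ≤ g → 0 ≤ L g) :
    ∃ ν : Measure X, IsFiniteMeasure ν ∧ ∀ g : C(X, ℝ), ∫ x, g x ∂ν = L g := by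
  let M : CompactlySupportedContinuousMap X ℝ →ₗ[ℝ] ℝ :=
    { toFun := fun g => L g.toContinuousMap
      map_add' := fun a b => L.map_add a.toContinuousMap b.toContinuousMap
      map_smul' := fun c a => L.map_smul c a.toContinuousMap }
  let Λ : CompactlySupportedContinuousMap X ℝ →ₚ[ℝ] ℝ :=
    { M with
      monotone' := fun a b hab => by
        have : 0 ≤ M (b - a) := hL _ fun x => sub_nonneg.2 (hab x)
        rw [map_sub] at this
        exact sub_nonneg.1 this }
  refine ⟨RealRMK.rieszMeasure Λ, inferInstance, fun g => ?_⟩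
  exact RealRMK.integral_rieszMeasure Λ ⟨g, HasCompactSupport.of_compactSpace _⟩

/-- A functional below the upper envelope over `K` at `t` is a measure on `K` that represents `t`,
and the Hahn–Banach theorem provides one whose value at `f` is the upper envelope of `f`. -/
theorem exists_measure_integral_eq_upperEnvelope [T2Space X]
    [SecondCountableTopology X]
    (h1 : (1 : C(X, ℝ)) ∈ A) (hK : IsClosed K)
    (ht : ∀ h ∈ A, (∀ x ∈ K, 0 ≤ h x) → 0 ≤ h t) {f : C(X, ℝ)} (hf : f ≠ 0) :
    ∃ ν : Measure X, IsProbabilityMeasure ν ∧ (∀ h ∈ A, ∫ x, h x ∂ν = h t) ∧ ν Kᶜ = 0 ∧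
      ∫ x, f x ∂ν = upperEnvelope A K t f := by
  obtain ⟨L, hLf, hL⟩ := exists_linearMap_le_upperEnvelope h1 ht hf
  have hle : ∀ g, (∀ x ∈ K, g x ≤ 0) → L g ≤ 0 := fun g hg =>
    (hL g).trans (upperEnvelope_le h1 ht A.zero_mem hg)
  obtain ⟨ν, hν, hνL⟩ := exists_measure_of_nonneg L fun g hg => by
    have := hle (-g) fun x _ => by simpa using hg x
    rw [map_neg] at this
    linarith
  have hA : ∀ h ∈ A, ∫ x, h x ∂ν = h t := fun h hh => by
    rw [hνL]
    have h2 := (hL h).trans (upperEnvelope_le h1 ht hh fun x _ => le_rfl)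
    have h3 := (hL (-h)).trans (upperEnvelope_le h1 ht (A.neg_mem hh) fun x _ => le_rfl)
    rw [map_neg, ContinuousMap.neg_apply] at h3
    linarith
  refine ⟨ν, ?_, hA, ?_, (hνL f).trans hLf⟩
  · have := hA 1 h1
    simp only [ContinuousMap.one_apply, integral_const, smul_eq_mul, mul_one] at this
    constructor
    exact (ENNReal.toReal_eq_one_iff _).1 this
  · refine measure_null_of_locally_null _ fun y hy => ?_
    obtain ⟨g, hg0, hg1, hg⟩ := exists_continuous_zero_one_of_isClosed hK
      (isClosed_singleton (x := y)) (Set.disjoint_singleton_right.2 hy)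
    have hint : ∫ x, g x ∂ν = 0 := by
      refine le_antisymm ?_ (integral_nonneg fun x => (hg x).1)
      rw [hνL]
      exact hle g fun x hx => (hg0 hx).le
    have hae := (integral_eq_zero_iff_of_nonneg (fun x => (hg x).1)
      (integrable_continuousMap ν g)).1 hint
    refine ⟨{x | g x ≠ 0}, mem_nhdsWithin_of_mem_nhds ?_, hae⟩
    refine (isOpen_ne_fun g.continuous continuous_const).mem_nhds ?_
    have : g y = 1 := hg1 rfl
    simp [this]

end Envelope

/-! ### The Riesz refinement property of the cone -/

section Cone

variable {E : Type*} [AddCommGroup E] [Module ℝ E] {Δ : Set E}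

theorem smul_mem_coneOver {r : ℝ} (hr : 0 ≤ r) {x : E} (hx : x ∈ Δ) :
    (r • x, r) ∈ coneOver Δ := ⟨r, hr, x, hx, rfl⟩

theorem zero_mem_coneOver (hne : Δ.Nonempty) : (0 : E × ℝ) ∈ coneOver Δ := by
  obtain ⟨x, hx⟩ := hne
  exact ⟨0, le_rfl, x, hx, by ext <;> simp⟩

theorem add_mem_coneOver (hc : Convex ℝ Δ) {u v : E × ℝ} (hu : u ∈ coneOver Δ)
    (hv : v ∈ coneOver Δ) : u + v ∈ coneOver Δ := by
  obtain ⟨r, hr, x, hx, rfl⟩ := hu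
  obtain ⟨s, hs, y, hy, rfl⟩ := hv
  rcases eq_or_lt_of_le (add_nonneg hr hs) with h | h
  · obtain rfl : r = 0 := by linarith
    obtain rfl : s = 0 := by linarith
    exact ⟨0, le_rfl, x, hx, by simp⟩
  · refine ⟨r + s, h.le, (r / (r + s)) • x + (s / (r + s)) • y,
      hc hx hy (by positivity) (by positivity) (by field_simp), ?_⟩
    ext
    · simp only [Prod.fst_add, smul_add, smul_smul]
      rw [mul_div_cancel₀ _ h.ne', mul_div_cancel₀ _ h.ne']
    · simp

theorem sum_mem_coneOver (hc : Convex ℝ Δ) (hne : Δ.Nonempty) {ι : Type*} (s : Finset ι)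
    {u : ι → E × ℝ} (hu : ∀ i ∈ s, u i ∈ coneOver Δ) : ∑ i ∈ s, u i ∈ coneOver Δ :=
  Finset.sum_induction _ (· ∈ coneOver Δ) (fun _ _ => add_mem_coneOver hc)
    (zero_mem_coneOver hne) hu

variable [TopologicalSpace E]

/-- The Riesz decomposition property: an element of the cone below a sum of two is the sum of two
elements below the summands.  The first part is the infimum `w + u - w ⊔ u` of `w` and `u`. -/
theorem exists_decomposition (hΔ : IsChoquetSimplex Δ) {w u v : E × ℝ} (hw : w ∈ coneOver Δ)
    (hu : u ∈ coneOver Δ) (hv : v ∈ coneOver Δ) (h : ConeLE Δ w (u + v)) :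
    ∃ w₁ w₂, w₁ ∈ coneOver Δ ∧ w₂ ∈ coneOver Δ ∧ ConeLE Δ w₁ u ∧ ConeLE Δ w₂ v ∧
      w = w₁ + w₂ := by
  obtain ⟨s, hs₁, hs₂, hs⟩ := hΔ.exists_sup w hw u hu
  have e₁ := hs (w + u) (by simpa [ConeLE] using hu) (by simpa [ConeLE] using hw)
  have e₂ := hs (u + v) h (by simpa [ConeLE] using hv)
  simp only [ConeLE] at *
  refine ⟨w + u - s, s - u, e₁, hs₂, ?_, ?_, by abel⟩
  · convert hs₁ using 1; abel
  · convert e₂ using 1; abel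

theorem exists_decomposition_sum (hΔ : IsChoquetSimplex Δ) (hne : Δ.Nonempty) {ι : Type*}
    (s : Finset ι) (v : ι → E × ℝ) (hv : ∀ i ∈ s, v i ∈ coneOver Δ) (w : E × ℝ)
    (hw : w ∈ coneOver Δ) (h : ConeLE Δ w (∑ i ∈ s, v i)) :
    ∃ z : ι → E × ℝ, (∀ i ∈ s, z i ∈ coneOver Δ ∧ ConeLE Δ (z i) (v i)) ∧
      w = ∑ i ∈ s, z i := by
  classical
  induction s using Finset.induction_on generalizing w with
  | empty =>
    refine ⟨0, by simp, ?_⟩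
    -- The cone is proper: `w` and `-w` both lie in it.
    obtain ⟨r, hr, x, hx, rfl⟩ := hw
    obtain ⟨r', hr', x', hx', h'⟩ := h
    have : r = 0 := by
      have := congrArg Prod.snd h'
      simp at this
      linarith
    simp [this]
  | insert j s hj ih =>
    rw [Finset.sum_insert hj] at h
    have hvs : ∀ i ∈ s, v i ∈ coneOver Δ := fun i hi => hv i (Finset.mem_insert_of_mem hi)
    obtain ⟨w₁, w₂, h₁, h₂, l₁, l₂, hsum⟩ := exists_decomposition hΔ hw
      (hv j (Finset.mem_insert_self j s)) (sum_mem_coneOver hΔ.convex hne s hvs) h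
    obtain ⟨z, hz, hz'⟩ := ih hvs w₂ h₂ l₂
    refine ⟨Function.update z j w₁, fun i hi => ?_, ?_⟩
    · rcases Finset.mem_insert.1 hi with rfl | hi
      · simpa using ⟨h₁, l₁⟩
      · rw [Function.update_of_ne (ne_of_mem_of_not_mem hi hj)]
        exact hz i hi
    · rw [Finset.sum_insert hj, Function.update_self, hsum, hz']
      congr 1
      refine Finset.sum_congr rfl fun i hi => ?_
      rw [Function.update_of_ne (ne_of_mem_of_not_mem hi hj)]

/-- The Riesz refinement property: two finite decompositions of an element of the cone have a
common refinement. -/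
theorem exists_refinement (hΔ : IsChoquetSimplex Δ) (hne : Δ.Nonempty) {ι κ : Type*}
    (s : Finset ι) (t : Finset κ) (u : ι → E × ℝ) (v : κ → E × ℝ)
    (hu : ∀ i ∈ s, u i ∈ coneOver Δ) (hv : ∀ j ∈ t, v j ∈ coneOver Δ)
    (h : ∑ i ∈ s, u i = ∑ j ∈ t, v j) :
    ∃ z : ι → κ → E × ℝ, (∀ i ∈ s, ∀ j ∈ t, z i j ∈ coneOver Δ) ∧
      (∀ i ∈ s, u i = ∑ j ∈ t, z i j) ∧ (∀ j ∈ t, v j = ∑ i ∈ s, z i j) := by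
  classical
  induction s using Finset.induction_on generalizing v with
  | empty =>
    refine ⟨0, by simp, by simp, fun j hj => ?_⟩
    have hsnd : ∀ i ∈ t, 0 ≤ (v i).2 := fun i hi => by
      obtain ⟨r, hr, x, hx, hp⟩ := hv i hi
      simpa [hp] using hr
    have h0 : ∑ i ∈ t, (v i).2 = 0 := by
      have := congrArg Prod.snd h
      simpa [Prod.snd_sum] using this.symm
    have hj0 := (Finset.sum_eq_zero_iff_of_nonneg hsnd).1 h0 j hj
    obtain ⟨r, hr, x, hx, hp⟩ := hv j hj
    simp only [hp] at hj0
    simp [hp, hj0]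
  | insert k s hk ih =>
    rw [Finset.sum_insert hk] at h
    have hus : ∀ i ∈ s, u i ∈ coneOver Δ := fun i hi => hu i (Finset.mem_insert_of_mem hi)
    obtain ⟨y, hy, hy'⟩ := exists_decomposition_sum hΔ hne t v hv (u k)
      (hu k (Finset.mem_insert_self k s)) (by
        rw [ConeLE, ← h, add_sub_cancel_left]
        exact sum_mem_coneOver hΔ.convex hne s hus)
    obtain ⟨z, hz, hz₁, hz₂⟩ := ih (fun j => v j - y j) hus (fun j hj => (hy j hj).2) (by
      rw [Finset.sum_sub_distrib, ← hy', ← h, add_sub_cancel_left])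
    have hne' : ∀ i ∈ s, i ≠ k := fun i hi => ne_of_mem_of_not_mem hi hk
    refine ⟨Function.update z k y, ?_, ?_, ?_⟩
    · intro i hi j hj
      rcases Finset.mem_insert.1 hi with rfl | hi
      · simpa using (hy j hj).1
      · rw [Function.update_of_ne (hne' i hi)]
        exact hz i hi j hj
    · intro i hi
      rcases Finset.mem_insert.1 hi with rfl | hi
      · simpa using hy'
      · rw [Function.update_of_ne (hne' i hi)]
        exact hz₁ i hi
    · intro j hj
      rw [Finset.sum_insert hk, Function.update_self,
        Finset.sum_congr rfl fun i hi => by rw [Function.update_of_ne (hne' i hi)],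
        ← hz₂ j hj]
      abel

end Cone

/-! ### Affine functions and barycenters -/

section Affine

variable {E : Type*} [AddCommGroup E] [Module ℝ E] [TopologicalSpace E]

/-- The space `A(Δ)` of continuous affine functions, as a subspace of `C(Δ, ℝ)`. -/
def affineFunctions (Δ : Set E) : Submodule ℝ C(Δ, ℝ) where
  carrier := {h | ∀ (x y z : Δ) (a b : ℝ), 0 ≤ a → 0 ≤ b → a + b = 1 →
    (z : E) = a • (x : E) + b • (y : E) → h z = a * h x + b * h y}
  add_mem' := fun {f g} hf hg x y z a b ha hb hab hz => by
    simp only [ContinuousMap.add_apply, hf x y z a b ha hb hab hz, hg x y z a b ha hb hab hz]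
    ring
  zero_mem' := fun x y z a b ha hb hab hz => by simp
  smul_mem' := fun c f hf x y z a b ha hb hab hz => by
    simp only [ContinuousMap.smul_apply, hf x y z a b ha hb hab hz, smul_eq_mul]
    ring

variable {Δ : Set E}

theorem one_mem_affineFunctions : (1 : C(Δ, ℝ)) ∈ affineFunctions Δ :=
  fun x y z a b ha hb hab hz => by simp [hab]

theorem restrict_mem_affineFunctions (φ : E →L[ℝ] ℝ) :
    (φ : C(E, ℝ)).restrict Δ ∈ affineFunctions Δ :=
  fun x y z a b ha hb hab hz => by simp [hz]

theorem isAffOn_extend {h : C(Δ, ℝ)} (hc : Convex ℝ Δ) (hh : h ∈ affineFunctions Δ) :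
    IsAffOn Δ (Function.extend Subtype.val h 0) where
  continuousOn := by
    rw [continuousOn_iff_continuous_domRestrict]
    convert h.continuous using 1
    ext x
    exact Subtype.val_injective.extend_apply h 0 x
  map_combo := fun x hx y hy a b ha hb hab => by
    have := hh ⟨x, hx⟩ ⟨y, hy⟩ ⟨_, hc hx hy ha hb hab⟩ a b ha hb hab rfl
    rw [← Subtype.val_injective.extend_apply h 0 ⟨x, hx⟩,
      ← Subtype.val_injective.extend_apply h 0 ⟨y, hy⟩,
      ← Subtype.val_injective.extend_apply h 0 ⟨_, hc hx hy ha hb hab⟩] at this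
    exact this

/-- `t` is the barycenter of the probability measure `ν` on `Δ`. -/
structure Represents [MeasurableSpace E] (ν : Measure Δ) (t : Δ) : Prop where
  isProbabilityMeasure : IsProbabilityMeasure ν
  integral_eq : ∀ h ∈ affineFunctions Δ, ∫ x, h x ∂ν = h t

variable [IsTopologicalAddGroup E] [ContinuousSMul ℝ E] [LocallyConvexSpace ℝ E] [T2Space E]

theorem eq_of_forall_affineFunctions {x y : Δ}
    (h : ∀ f ∈ affineFunctions Δ, f x = f y) : x = y := by
  by_contra hne
  obtain ⟨φ, hφ⟩ := geometric_hahn_banach_point_point (E := E) (x := x) (y := y)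
    fun h => hne (Subtype.ext h)
  exact hφ.ne (h _ (restrict_mem_affineFunctions φ))

variable [MeasurableSpace E] [BorelSpace E]

omit [IsTopologicalAddGroup E] [ContinuousSMul ℝ E] [LocallyConvexSpace ℝ E] [T2Space E] in
/-- Every probability measure on a compact convex set has a barycenter: finitely many affine
functions together map `Δ` onto a compact convex set, which contains the mean value. -/
theorem exists_represents [CompactSpace Δ] (hc : Convex ℝ Δ) (ν : Measure Δ)
    [IsProbabilityMeasure ν] : ∃ t : Δ, Represents ν t := by
  suffices H : (⋂ h : affineFunctions Δ, {x : Δ | h.1 x = ∫ y, h.1 y ∂ν}).Nonempty by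
    obtain ⟨t, ht⟩ := H
    exact ⟨t, inferInstance, fun h hh => (Set.mem_iInter.1 ht ⟨h, hh⟩).symm⟩
  refine CompactSpace.iInter_nonempty (fun h => isClosed_eq h.1.continuous continuous_const)
    fun s => ?_
  let Φ : Δ → s → ℝ := fun x h => h.1.1 x
  have hΦ : Continuous Φ := continuous_pi fun h => h.1.1.continuous
  have hconv : Convex ℝ (Set.range Φ) := by
    rintro _ ⟨x, rfl⟩ _ ⟨y, rfl⟩ a b ha hb hab
    refine ⟨⟨_, hc x.2 y.2 ha hb hab⟩, ?_⟩
    ext h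
    exact h.1.2 x y _ a b ha hb hab rfl
  have hint : Integrable Φ ν := Integrable.of_eval fun h => integrable_continuousMap ν h.1.1
  obtain ⟨x, hx⟩ := hconv.integral_mem (isCompact_range hΦ).isClosed
    (Filter.Eventually.of_forall fun x => Set.mem_range_self x) hint
  refine ⟨x, Set.mem_iInter₂.2 fun h hh => ?_⟩
  have := congrFun hx ⟨h, hh⟩
  exact this.trans (eval_integral (f := Φ) (fun h => integrable_continuousMap ν h.1.1) ⟨h, hh⟩)

omit [IsTopologicalAddGroup E] [ContinuousSMul ℝ E] [LocallyConvexSpace ℝ E] [T2Space E] in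
theorem exists_integral_eq_measure_mul [CompactSpace Δ] [Nonempty Δ] (hc : Convex ℝ Δ)
    (σ : Measure Δ) [IsFiniteMeasure σ] :
    ∃ t : Δ, ∀ h ∈ affineFunctions Δ, ∫ x, h x ∂σ = σ.real Set.univ * h t := by
  rcases eq_or_ne σ 0 with rfl | hσ
  · exact ⟨Classical.arbitrary Δ, by simp⟩
  have : NeZero σ := ⟨hσ⟩
  obtain ⟨t, -, ht⟩ := exists_represents hc ((σ Set.univ)⁻¹ • σ)
  refine ⟨t, fun h hh => ?_⟩
  rw [← ht h hh, integral_smul_measure, ENNReal.toReal_inv, smul_eq_mul, ← mul_assoc]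
  rw [Measure.real, mul_inv_cancel₀, one_mul]
  simp [ENNReal.toReal_eq_zero_iff, hσ]

/-- Splitting a representing measure along a measurable set splits the point. -/
theorem Represents.exists_split [CompactSpace Δ] (hc : Convex ℝ Δ) {ν : Measure Δ} {t : Δ}
    (hν : Represents ν t) {B : Set Δ} (hB : MeasurableSet B) :
    ∃ u v : Δ, (t : E) = ν.real B • (u : E) + (1 - ν.real B) • (v : E) ∧
      ∀ h ∈ affineFunctions Δ, ∫ x in B, h x ∂ν = ν.real B * h u := by
  have := hν.isProbabilityMeasure
  have : Nonempty Δ := ⟨t⟩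
  obtain ⟨u, hu⟩ := exists_integral_eq_measure_mul hc (ν.restrict B)
  obtain ⟨v, hv⟩ := exists_integral_eq_measure_mul hc (ν.restrict Bᶜ)
  simp only [measureReal_restrict_apply MeasurableSet.univ, Set.univ_inter] at hu hv
  rw [probReal_compl_eq_one_sub hB] at hv
  refine ⟨u, v, ?_, hu⟩
  have h0 : 0 ≤ ν.real B := measureReal_nonneg
  have h1 : 0 ≤ 1 - ν.real B := sub_nonneg.2 measureReal_le_one
  let w : Δ := ⟨_, hc u.2 v.2 h0 h1 (by ring)⟩
  have : t = w := eq_of_forall_affineFunctions fun h hh => by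
    rw [hh u v w _ _ h0 h1 (by ring) rfl, ← hu h hh, ← hv h hh,
      integral_add_compl hB (integrable_continuousMap ν h), hν.integral_eq h hh]
  exact congrArg Subtype.val this

omit [T2Space E] in
/-- The barycenter of a measure on `K` lies in the closed convex hull of `K`. -/
theorem Represents.mem_closure_convexHull [CompactSpace Δ] {ν : Measure Δ} {t : Δ}
    (hν : Represents ν t) {K : Set Δ} (hK : ν Kᶜ = 0) :
    (t : E) ∈ closure (convexHull ℝ (Subtype.val '' K)) := by
  have := hν.isProbabilityMeasure
  by_contra ht
  obtain ⟨φ, u, hφ, hu⟩ := geometric_hahn_banach_closed_point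
    (convex_convexHull ℝ (Subtype.val '' K)).closure isClosed_closure ht
  have h1 := hν.integral_eq _ (restrict_mem_affineFunctions φ)
  have h2 : ∫ x, (φ : C(E, ℝ)).restrict Δ x ∂ν ≤ ∫ x, u ∂ν := by
    refine integral_mono_ae (integrable_continuousMap ν _) (integrable_const u) ?_
    filter_upwards [measure_eq_zero_iff_ae_notMem.1 hK] with x hx
    exact (hφ x (subset_closure (subset_convexHull ℝ _ ⟨x, not_not.1 hx, rfl⟩))).le
  rw [h1] at h2
  simp only [integral_const, probReal_univ, smul_eq_mul, one_mul] at h2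
  exact absurd hu (not_lt.2 h2)

omit [IsTopologicalAddGroup E] [ContinuousSMul ℝ E] [LocallyConvexSpace ℝ E] [MeasurableSpace E]
  [BorelSpace E] in
theorem nonneg_of_mem_closure_convexHull [CompactSpace Δ] (hc : Convex ℝ Δ) {K : Set Δ} {t : Δ}
    (ht : (t : E) ∈ closure (convexHull ℝ (Subtype.val '' K))) (h : C(Δ, ℝ))
    (hh : h ∈ affineFunctions Δ) (hK : ∀ x ∈ K, 0 ≤ h x) : 0 ≤ h t := by
  have hsub : closure (convexHull ℝ (Subtype.val '' K)) ⊆ Subtype.val '' {x : Δ | 0 ≤ h x} := by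
    refine closure_minimal (convexHull_min (Set.image_mono hK) ?_) ?_
    · rintro _ ⟨x, hx, rfl⟩ _ ⟨y, hy, rfl⟩ a b ha hb hab
      refine ⟨⟨_, hc x.2 y.2 ha hb hab⟩, ?_, rfl⟩
      rw [Set.mem_ofPred_eq, hh x y _ a b ha hb hab rfl]
      exact add_nonneg (mul_nonneg ha hx) (mul_nonneg hb hy)
    · exact ((isClosed_le continuous_const h.continuous).isCompact.image
        continuous_subtype_val).isClosed
  obtain ⟨x, hx, hxt⟩ := hsub ht
  rwa [Subtype.ext hxt] at hx

omit [IsTopologicalAddGroup E] [ContinuousSMul ℝ E] [LocallyConvexSpace ℝ E] in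
/-- A measure on the compact set `K` represents each point of the closed convex hull of `K`. -/
theorem exists_represents_of_mem_closure_convexHull [CompactSpace Δ] [SecondCountableTopology Δ]
    (hc : Convex ℝ Δ) {K : Set Δ} (hK : IsClosed K) {t : Δ}
    (ht : (t : E) ∈ closure (convexHull ℝ (Subtype.val '' K))) :
    ∃ ν : Measure Δ, Represents ν t ∧ ν Kᶜ = 0 := by
  have : Nonempty Δ := ⟨t⟩
  obtain ⟨ν, hν, hA, hν0, -⟩ := exists_measure_integral_eq_upperEnvelope
    (one_mem_affineFunctions (Δ := Δ)) hK (nonneg_of_mem_closure_convexHull hc ht)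
    (one_ne_zero (α := C(Δ, ℝ)))
  exact ⟨ν, ⟨hν, hA⟩, hν0⟩

/-! ### Extreme points -/

/-- The extreme points of `Δ`, as a subset of the subtype `Δ`. -/
def extremeSet (Δ : Set E) : Set Δ := {x | (x : E) ∈ Δ.extremePoints ℝ}

/-- The only measure representing an extreme point is the point mass. -/
theorem Represents.compl_singleton_null [CompactSpace Δ] [SecondCountableTopology Δ]
    (hc : Convex ℝ Δ) {ν : Measure Δ} {t : Δ} (hν : Represents ν t) (ht : t ∈ extremeSet Δ) :
    ν {t}ᶜ = 0 := by
  have := hν.isProbabilityMeasure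
  refine measure_null_of_locally_null _ fun y hy => ?_
  obtain ⟨h, hh, hlt⟩ : ∃ h ∈ affineFunctions Δ, h t < h y := by
    by_contra! hle
    refine hy (eq_of_forall_affineFunctions fun f hf => le_antisymm (hle f hf) ?_)
    have := hle (-f) (Submodule.neg_mem _ hf)
    simpa using this
  have hopen : IsOpen {x : Δ | h t < h x} := isOpen_lt continuous_const h.continuous
  refine ⟨{x | h t < h x}, mem_nhdsWithin_of_mem_nhds (hopen.mem_nhds hlt), ?_⟩
  by_contra hpos
  obtain ⟨u, v, huv, hu⟩ := hν.exists_split hc hopen.measurableSet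
  set m := ν.real {x : Δ | h t < h x} with hm
  have hm0 : 0 < m := ENNReal.toReal_pos hpos (measure_ne_top _ _)
  have hut : u = t := by
    rcases eq_or_lt_of_le (measureReal_le_one : m ≤ 1) with h1 | h1
    · rw [show m = 1 from h1] at huv
      exact Subtype.ext (by simpa using huv.symm)
    · have := (mem_extremePoints.1 ht).2 u u.2 v v.2
        ⟨m, 1 - m, hm0, sub_pos.2 h1, by ring, huv.symm⟩
      exact Subtype.ext this.1
  have hint : ∫ x in {x : Δ | h t < h x}, (h x - h t) ∂ν = 0 := by
    rw [integral_sub (integrable_continuousMap _ h) (integrable_const _), hu h hh, hut]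
    simp [← hm]
  have hpos' := (setIntegral_pos_iff_support_of_nonneg_ae (μ := ν)
    (s := {x : Δ | h t < h x}) (f := fun x => h x - h t) (by
      filter_upwards [ae_restrict_mem hopen.measurableSet] with x hx
      exact (sub_pos.2 hx).le)
    ((integrable_continuousMap _ h).sub (integrable_const _))).2 (by
      refine (pos_iff_ne_zero.2 hpos).trans_le (measure_mono fun x hx => ⟨?_, hx⟩)
      exact (sub_pos.2 hx).ne')
  exact hpos'.ne' hint

/-- A continuous function agrees at an extreme point with its upper envelope. -/
theorem exists_affine_ge_lt_of_mem_extremeSet [CompactSpace Δ] [SecondCountableTopology Δ]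
    (hc : Convex ℝ Δ) {t : Δ} (ht : t ∈ extremeSet Δ) (f : C(Δ, ℝ)) {δ : ℝ} (hδ : 0 < δ) :
    ∃ h ∈ affineFunctions Δ, (∀ x, f x ≤ h x) ∧ h t < f t + δ := by
  rcases eq_or_ne f 0 with rfl | hf
  · exact ⟨0, Submodule.zero_mem _, fun x => le_rfl, by simpa using hδ⟩
  obtain ⟨ν, hν, hA, -, hνf⟩ := exists_measure_integral_eq_upperEnvelope (t := t)
    (one_mem_affineFunctions (Δ := Δ)) isClosed_univ (fun h _ h0 => h0 t trivial) hf
  have hae : ∀ᵐ x ∂ν, x = t :=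
    Represents.compl_singleton_null hc ⟨hν, hA⟩ ht
  have : ∫ x, f x ∂ν = f t := by
    rw [integral_congr_ae (hae.mono fun x hx => congrArg f hx)]
    simp
  obtain ⟨h, hh, hle, hlt⟩ := exists_lt_upperEnvelope_add (K := Set.univ) (t := t)
    (one_mem_affineFunctions (Δ := Δ)) f hδ
  exact ⟨h, hh, fun x => hle x trivial, by rwa [← this, hνf]⟩

omit [TopologicalSpace E] [IsTopologicalAddGroup E] [ContinuousSMul ℝ E]
  [LocallyConvexSpace ℝ E] [T2Space E] [MeasurableSpace E] [BorelSpace E] in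
theorem exists_midpoint_of_notMem_extremePoints (hc : Convex ℝ Δ) {z : E} (hz : z ∈ Δ)
    (hne : z ∉ Δ.extremePoints ℝ) :
    ∃ x ∈ Δ, ∃ y ∈ Δ, x ≠ y ∧ z = (1 / 2 : ℝ) • x + (1 / 2 : ℝ) • y := by
  rw [mem_extremePoints] at hne
  push Not at hne
  obtain ⟨x, hx, y, hy, ⟨a, b, ha, hb, hab, rfl⟩, hxy⟩ := hne hz
  have hxy' : x ≠ y := by
    rintro rfl
    have : a • x + b • x = x := by rw [← add_smul, hab, one_smul]
    exact hxy this.symm this.symm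
  -- Move from `z` by `c • (x - y)` in both directions, `c` being the smaller coefficient.
  obtain ⟨c, hc0, hca, hcb⟩ : ∃ c, 0 < c ∧ c ≤ a ∧ c ≤ b :=
    ⟨min a b, lt_min ha hb, min_le_left _ _, min_le_right _ _⟩
  refine ⟨(a + c) • x + (b - c) • y, hc hx hy (by linarith) (by linarith) (by linarith),
    (a - c) • x + (b + c) • y, hc hx hy (by linarith) (by linarith) (by linarith), ?_, by module⟩
  intro h
  have h2 : (2 * c) • (x - y) = 0 := by
    rw [← sub_eq_zero] at h
    rw [← h]
    module
  rcases smul_eq_zero.1 h2 with h3 | h3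
  · linarith
  · exact hxy' (sub_eq_zero.1 h3)

omit [MeasurableSpace E] [BorelSpace E] in
/-- On a metrizable compact set there is a strictly convex continuous function: a convergent
weighted sum of the squares of countably many affine functions that separate points. -/
theorem exists_strictConvex [CompactSpace Δ] [SecondCountableTopology Δ] [Nonempty Δ] :
    ∃ F : C(Δ, ℝ), F ≠ 0 ∧ ∀ x y z : Δ, x ≠ y →
      (z : E) = (1 / 2 : ℝ) • (x : E) + (1 / 2 : ℝ) • (y : E) → F z < (F x + F y) / 2 := by
  obtain ⟨T, hT, hTu⟩ := TopologicalSpace.isOpen_iUnion_countable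
    (fun h : affineFunctions Δ => {p : Δ × Δ | h.1 p.1 ≠ h.1 p.2})
    (fun h => isOpen_ne_fun (h.1.continuous.comp continuous_fst)
      (h.1.continuous.comp continuous_snd))
  obtain ⟨a, ha⟩ := (hT.insert 0).exists_eq_range (Set.insert_nonempty 0 T)
  have hsep : ∀ x y : Δ, x ≠ y → ∃ n, (a n).1 x ≠ (a n).1 y := fun x y hxy => by
    obtain ⟨h, hh, hne⟩ : ∃ h ∈ affineFunctions Δ, h x ≠ h y := by
      by_contra! hall
      exact hxy (eq_of_forall_affineFunctions hall)
    have : (x, y) ∈ ⋃ h : affineFunctions Δ, {p : Δ × Δ | h.1 p.1 ≠ h.1 p.2} :=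
      Set.mem_iUnion.2 ⟨⟨h, hh⟩, hne⟩
    rw [← hTu] at this
    obtain ⟨g, hg, hgne⟩ := Set.mem_iUnion₂.1 this
    obtain ⟨n, rfl⟩ : g ∈ Set.range a := ha ▸ Set.mem_insert_of_mem 0 hg
    exact ⟨n, hgne⟩
  obtain ⟨c, hcpos, hsum⟩ : ∃ c : ℕ → ℝ, (∀ n, 0 < c n) ∧
      Summable fun n => c n • (a n).1 ^ 2 := by
    refine ⟨fun n => (1 / 2) ^ n * (1 + ‖(a n).1 ^ 2‖)⁻¹, fun n => by positivity,
      Summable.of_norm_bounded summable_geometric_two fun n => ?_⟩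
    rw [norm_smul, Real.norm_of_nonneg (by positivity), mul_assoc]
    refine mul_le_of_le_one_right (by positivity) ?_
    rw [inv_mul_le_one₀ (by positivity)]
    linarith
  have hF : ∀ x, HasSum (fun n => c n * (a n).1 x ^ 2) ((∑' n, c n • (a n).1 ^ 2 : C(Δ, ℝ)) x) :=
    fun x => by simpa using ContinuousMap.hasSum_apply hsum.hasSum x
  refine ⟨1 + ∑' n, c n • (a n).1 ^ 2, fun h0 => ?_, fun x y z hxy hz => ?_⟩
  · obtain ⟨x⟩ := ‹Nonempty Δ›
    have h1 := congrArg (fun f : C(Δ, ℝ) => f x) h0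
    have h2 := (hF x).nonneg fun n => mul_nonneg (hcpos n).le (sq_nonneg _)
    simp only [ContinuousMap.add_apply, ContinuousMap.one_apply, ContinuousMap.zero_apply] at h1
    linarith
  · obtain ⟨n, hn⟩ := hsep x y hxy
    have key := (((hF x).add (hF y)).div_const 2).sub (hF z)
    have heq : ∀ k, (c k * (a k).1 x ^ 2 + c k * (a k).1 y ^ 2) / 2 - c k * (a k).1 z ^ 2 =
        c k * ((a k).1 x - (a k).1 y) ^ 2 / 4 := fun k => by
      rw [(a k).2 x y z _ _ (by norm_num) (by norm_num) (by norm_num) hz]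
      ring
    simp only [heq] at key
    have hpos : 0 < c n * ((a n).1 x - (a n).1 y) ^ 2 / 4 :=
      div_pos (mul_pos (hcpos n) (sq_pos_of_ne_zero (sub_ne_zero.2 hn))) (by norm_num)
    have hnonneg : ∀ k, 0 ≤ c k * ((a k).1 x - (a k).1 y) ^ 2 / 4 := fun k =>
      div_nonneg (mul_nonneg (hcpos k).le (sq_nonneg _)) (by norm_num)
    have h0 := hpos.trans_le (le_hasSum key n fun k _ => hnonneg k)
    simp only [ContinuousMap.add_apply, ContinuousMap.one_apply]
    linarith

theorem measurableSet_extremeSet [CompactSpace Δ] [SecondCountableTopology Δ]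
    (hc : Convex ℝ Δ) : MeasurableSet (extremeSet Δ) := by
  rcases isEmpty_or_nonempty Δ with hE | hE
  · exact Subsingleton.measurableSet
  obtain ⟨F, -, hF⟩ := exists_strictConvex (Δ := Δ)
  let mid : Δ × Δ → Δ := fun p => ⟨(1 / 2 : ℝ) • (p.1 : E) + (1 / 2 : ℝ) • (p.2 : E),
    hc p.1.2 p.2.2 (by norm_num) (by norm_num) (by norm_num)⟩
  have hmid : Continuous mid := by fun_prop
  let C : ℕ → Set (Δ × Δ) := fun n => {p | F (mid p) + 1 / (n + 1) ≤ (F p.1 + F p.2) / 2}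
  have hC : ∀ n, IsClosed (mid '' C n) := fun n =>
    ((isClosed_le (by fun_prop) (by fun_prop)).isCompact.image hmid).isClosed
  have : (extremeSet Δ)ᶜ = ⋃ n, mid '' C n := by
    ext z
    simp only [Set.mem_iUnion]
    constructor
    · intro hz
      obtain ⟨x, hx, y, hy, hxy, hzxy⟩ := exists_midpoint_of_notMem_extremePoints hc z.2 hz
      have hlt := hF ⟨x, hx⟩ ⟨y, hy⟩ z (fun h => hxy (congrArg Subtype.val h)) hzxy
      obtain ⟨n, hn⟩ := exists_nat_one_div_lt (sub_pos.2 hlt)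
      have hzm : mid (⟨x, hx⟩, ⟨y, hy⟩) = z := Subtype.ext hzxy.symm
      refine ⟨n, (⟨x, hx⟩, ⟨y, hy⟩), ?_, hzm⟩
      change F (mid _) + _ ≤ _
      rw [hzm]
      linarith
    · rintro ⟨n, ⟨x, y⟩, hp, rfl⟩ hext
      have hmem := (mem_extremePoints.1 hext).2 x x.2 y y.2
        ⟨1 / 2, 1 / 2, by norm_num, by norm_num, by norm_num, rfl⟩
      have hx : x = mid (x, y) := Subtype.ext hmem.1
      have hy : y = mid (x, y) := Subtype.ext hmem.2
      change F (mid (x, y)) + 1 / (n + 1) ≤ (F x + F y) / 2 at hp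
      have hn : (0 : ℝ) < 1 / (n + 1) := by positivity
      rw [← hx] at hp hy
      rw [hy] at hp
      linarith
  rw [← compl_compl (extremeSet Δ), this]
  exact (MeasurableSet.iUnion fun n => (hC n).measurableSet).compl

/-- **Choquet's theorem**: every point of a metrizable compact convex set is represented by a
measure on the extreme points.  A measure that maximizes the integral of a strictly convex function
`F` among those representing `t` lives where `F` agrees with its upper envelope. -/
theorem exists_represents_extremeSet [CompactSpace Δ] [SecondCountableTopology Δ]
    (hc : Convex ℝ Δ) (t : Δ) :
    ∃ ν : Measure Δ, Represents ν t ∧ ν (extremeSet Δ)ᶜ = 0 := by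
  have : Nonempty Δ := ⟨t⟩
  obtain ⟨F, hF0, hF⟩ := exists_strictConvex (Δ := Δ)
  obtain ⟨ν, hν, hA, -, hνF⟩ := exists_measure_integral_eq_upperEnvelope (t := t)
    (one_mem_affineFunctions (Δ := Δ)) isClosed_univ (fun h _ h0 => h0 t trivial) hF0
  refine ⟨ν, ⟨hν, hA⟩, ?_⟩
  have hex : ∀ n : ℕ, ∃ h ∈ affineFunctions Δ, (∀ x, F x ≤ h x) ∧
      ∫ x, (h x - F x) ∂ν < 1 / (n + 1) := fun n => by
    obtain ⟨h, hh, hle, hlt⟩ := exists_lt_upperEnvelope_add (K := Set.univ) (t := t)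
      (one_mem_affineFunctions (Δ := Δ)) F (Nat.one_div_pos_of_nat (α := ℝ) (n := n))
    refine ⟨h, hh, fun x => hle x trivial, ?_⟩
    rw [integral_sub (integrable_continuousMap ν h) (integrable_continuousMap ν F), hA h hh, hνF]
    linarith
  choose h hh hle hlt using hex
  -- By Markov's inequality, `inf (h n - F)` vanishes almost everywhere.
  have hnull : ∀ m : ℕ, ν {x | ∀ n, 1 / ((m : ℝ) + 1) ≤ h n x - F x} = 0 := fun m => by
    set S : Set Δ := {x | ∀ n, 1 / ((m : ℝ) + 1) ≤ h n x - F x}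
    have hm : (0 : ℝ) < 1 / (m + 1) := by positivity
    rw [← measureReal_eq_zero_iff]
    by_contra hne
    have hpos : 0 < 1 / ((m : ℝ) + 1) * ν.real S :=
      mul_pos hm (lt_of_le_of_ne measureReal_nonneg (Ne.symm hne))
    obtain ⟨n, hn⟩ := exists_nat_one_div_lt hpos
    have h1 := mul_meas_ge_le_integral_of_nonneg (μ := ν) (f := fun x => h n x - F x)
      (Filter.Eventually.of_forall fun x => sub_nonneg.2 (hle n x))
      ((integrable_continuousMap ν (h n)).sub (integrable_continuousMap ν F)) (1 / ((m : ℝ) + 1))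
    have h2 : ν.real S ≤ ν.real {x | 1 / ((m : ℝ) + 1) ≤ h n x - F x} :=
      measureReal_mono fun x hx => hx n
    have h3 := mul_le_mul_of_nonneg_left h2 hm.le
    linarith [hlt n]
  refine measure_mono_null (fun z hz => ?_) (measure_iUnion_null hnull)
  obtain ⟨x, hx, y, hy, hxy, hzxy⟩ := exists_midpoint_of_notMem_extremePoints hc z.2 hz
  have hgap := hF ⟨x, hx⟩ ⟨y, hy⟩ z (fun h => hxy (congrArg Subtype.val h)) hzxy
  obtain ⟨m, hm⟩ := exists_nat_one_div_lt (sub_pos.2 hgap)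
  refine Set.mem_iUnion.2 ⟨m, fun n => ?_⟩
  have h1 := hh n ⟨x, hx⟩ ⟨y, hy⟩ z _ _ (by norm_num) (by norm_num) (by norm_num) hzxy
  have h2 := hle n ⟨x, hx⟩
  have h3 := hle n ⟨y, hy⟩
  linarith

/-- Inner regularity of a measure on the extreme points. -/
theorem exists_isCompact_subset_extremeSet [CompactSpace Δ] [SecondCountableTopology Δ]
    (hc : Convex ℝ Δ) (ν : Measure Δ) [IsFiniteMeasure ν] (hν : ν (extremeSet Δ)ᶜ = 0)
    {ε : ℝ} (hε : 0 < ε) : ∃ K ⊆ extremeSet Δ, IsCompact K ∧ ν.real Kᶜ < ε := by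
  let _ := TopologicalSpace.metrizableSpaceMetric Δ
  obtain ⟨K, hKs, hK, hlt⟩ := (measurableSet_extremeSet hc).exists_isCompact_sdiff_lt
    (μ := ν) (measure_ne_top _ _) (ENNReal.ofReal_pos.2 hε).ne'
  refine ⟨K, hKs, hK, ?_⟩
  have : ν Kᶜ ≤ ν (extremeSet Δ \ K) := by
    calc ν Kᶜ ≤ ν ((extremeSet Δ \ K) ∪ (extremeSet Δ)ᶜ) := measure_mono fun x hx => by
          by_cases h : x ∈ extremeSet Δ
          exacts [Or.inl ⟨h, hx⟩, Or.inr h]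
      _ ≤ _ := (measure_union_le _ _).trans (by rw [hν, add_zero])
  rw [Measure.real, ← ENNReal.toReal_ofReal hε.le]
  exact (ENNReal.toReal_lt_toReal (measure_ne_top _ _) ENNReal.ofReal_ne_top).2
    (this.trans_lt hlt)

end Affine

/-! ### Affine functions as additive functions on the cone -/

section ConeEval

variable {E : Type*} [AddCommGroup E] [Module ℝ E] [TopologicalSpace E] {Δ : Set E}

/-- The positively homogeneous extension of `h` to the cone over `Δ`: its value at `(r • x, r)` is
`r * h x`. -/
noncomputable def coneEval (h : C(Δ, ℝ)) (p : E × ℝ) : ℝ :=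
  p.2 * Function.extend Subtype.val h 0 (p.2⁻¹ • p.1)

theorem coneEval_smul (h : C(Δ, ℝ)) (r : ℝ) (x : Δ) : coneEval h (r • (x : E), r) = r * h x := by
  rcases eq_or_ne r 0 with rfl | hr
  · simp [coneEval]
  · simp only [coneEval]
    rw [inv_smul_smul₀ hr, Subtype.val_injective.extend_apply]

@[simp]
theorem coneEval_zero (h : C(Δ, ℝ)) : coneEval h 0 = 0 := by simp [coneEval]

theorem coneEval_add (hc : Convex ℝ Δ) {h : C(Δ, ℝ)} (hh : h ∈ affineFunctions Δ) {u v : E × ℝ}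
    (hu : u ∈ coneOver Δ) (hv : v ∈ coneOver Δ) :
    coneEval h (u + v) = coneEval h u + coneEval h v := by
  obtain ⟨r, hr, x, hx, rfl⟩ := hu
  obtain ⟨s, hs, y, hy, rfl⟩ := hv
  rcases eq_or_lt_of_le (add_nonneg hr hs) with h0 | h0
  · obtain rfl : r = 0 := by linarith
    obtain rfl : s = 0 := by linarith
    simp [coneEval]
  · have ha : 0 ≤ r / (r + s) := by positivity
    have hb : 0 ≤ s / (r + s) := by positivity
    have hab : r / (r + s) + s / (r + s) = 1 := by field_simp
    have hz : (r • x, r) + (s • y, s) =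
        ((r + s) • ((r / (r + s)) • x + (s / (r + s)) • y), r + s) := by
      ext
      · simp only [Prod.fst_add, smul_add, smul_smul]
        rw [mul_div_cancel₀ _ h0.ne', mul_div_cancel₀ _ h0.ne']
      · simp
    rw [hz, coneEval_smul h (r + s) ⟨_, hc hx hy ha hb hab⟩, coneEval_smul h r ⟨x, hx⟩,
      coneEval_smul h s ⟨y, hy⟩, hh ⟨x, hx⟩ ⟨y, hy⟩ _ _ _ ha hb hab rfl]
    field_simp

theorem coneEval_sum (hc : Convex ℝ Δ) (hne : Δ.Nonempty) {h : C(Δ, ℝ)}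
    (hh : h ∈ affineFunctions Δ) {ι : Type*} (s : Finset ι) {u : ι → E × ℝ}
    (hu : ∀ i ∈ s, u i ∈ coneOver Δ) :
    coneEval h (∑ i ∈ s, u i) = ∑ i ∈ s, coneEval h (u i) := by
  classical
  induction s using Finset.induction_on with
  | empty => simp
  | insert j s hj ih =>
    have hus : ∀ i ∈ s, u i ∈ coneOver Δ := fun i hi => hu i (Finset.mem_insert_of_mem hi)
    rw [Finset.sum_insert hj, Finset.sum_insert hj, coneEval_add hc hh
      (hu j (Finset.mem_insert_self j s)) (sum_mem_coneOver hc hne s hus), ih hus]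

theorem coneEval_mono {a b : C(Δ, ℝ)} (hab : ∀ x, a x ≤ b x) {p : E × ℝ}
    (hp : p ∈ coneOver Δ) : coneEval a p ≤ coneEval b p := by
  obtain ⟨r, hr, x, hx, rfl⟩ := hp
  rw [coneEval_smul a r ⟨x, hx⟩, coneEval_smul b r ⟨x, hx⟩]
  exact mul_le_mul_of_nonneg_left (hab _) hr

variable [IsTopologicalAddGroup E] [ContinuousSMul ℝ E] [LocallyConvexSpace ℝ E] [T2Space E]

theorem eq_of_forall_coneEval {p q : E × ℝ} (hp : p ∈ coneOver Δ) (hq : q ∈ coneOver Δ)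
    (h : ∀ f ∈ affineFunctions Δ, coneEval f p = coneEval f q) : p = q := by
  obtain ⟨r, hr, x, hx, rfl⟩ := hp
  obtain ⟨s, hs, y, hy, rfl⟩ := hq
  have h' : ∀ f ∈ affineFunctions Δ, r * f ⟨x, hx⟩ = s * f ⟨y, hy⟩ := fun f hf => by
    simpa only [coneEval_smul f r ⟨x, hx⟩, coneEval_smul f s ⟨y, hy⟩] using h f hf
  obtain rfl : r = s := by simpa using h' 1 one_mem_affineFunctions
  rcases eq_or_ne r 0 with rfl | hr0
  · simp
  · have : (⟨x, hx⟩ : Δ) = ⟨y, hy⟩ :=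
      eq_of_forall_affineFunctions fun f hf => mul_left_cancel₀ hr0 (h' f hf)
    rw [Subtype.mk.inj this]

end ConeEval

/-! ### Uniqueness of boundary measures -/

section Uniqueness

variable {E : Type*} [AddCommGroup E] [Module ℝ E] [TopologicalSpace E] [MeasurableSpace E]
  [BorelSpace E] {Δ : Set E}

/-- A finite measure, cut into the pieces on which `f` agrees with the members of a finite set of
affine functions, gives elements of the cone: the barycenters of the pieces, weighted by mass. -/
theorem exists_cone_partition [CompactSpace Δ] (hc : Convex ℝ Δ) (hne : Δ.Nonempty)
    (f : C(Δ, ℝ)) (s : Finset C(Δ, ℝ)) (hs : ∀ a ∈ s, a ∈ affineFunctions Δ) (σ : Measure Δ)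
    [IsFiniteMeasure σ] (hf : ∀ᵐ x ∂σ, ∃ a ∈ s, f x = a x) :
    ∃ u : C(Δ, ℝ) → E × ℝ, (∀ a ∈ s, u a ∈ coneOver Δ) ∧
      (∀ h ∈ affineFunctions Δ, ∑ a ∈ s, coneEval h (u a) = ∫ x, h x ∂σ) ∧
      ∑ a ∈ s, coneEval a (u a) = ∫ x, f x ∂σ := by
  classical
  have : Nonempty Δ := hne.to_subtype
  induction s using Finset.induction_on generalizing σ with
  | empty =>
    have : σ = 0 := by simpa using hf
    exact ⟨0, by simp [this]⟩
  | insert b s hb ih =>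
    set B : Set Δ := {x | f x = b x}
    have hB : MeasurableSet B := (isClosed_eq f.continuous b.continuous).measurableSet
    have hbA := hs b (Finset.mem_insert_self b s)
    obtain ⟨u, hu, hu₁, hu₂⟩ := ih (fun a ha => hs a (Finset.mem_insert_of_mem ha))
      (σ.restrict Bᶜ) (by
        filter_upwards [ae_restrict_of_ae hf, ae_restrict_mem hB.compl] with x hx hxB
        obtain ⟨a, ha, hax⟩ := hx
        rcases Finset.mem_insert.1 ha with rfl | ha
        exacts [absurd hax hxB, ⟨a, ha, hax⟩])
    obtain ⟨t, ht⟩ := exists_integral_eq_measure_mul hc (σ.restrict B)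
    set r := (σ.restrict B).real Set.univ
    have hr : 0 ≤ r := measureReal_nonneg
    have hupd : ∀ h : C(Δ, ℝ), ∑ a ∈ s, coneEval h (Function.update u b (r • (t : E), r) a) =
        ∑ a ∈ s, coneEval h (u a) := fun h => Finset.sum_congr rfl fun a ha => by
      rw [Function.update_of_ne (ne_of_mem_of_not_mem ha hb)]
    have hupd' : ∑ a ∈ s, coneEval a (Function.update u b (r • (t : E), r) a) =
        ∑ a ∈ s, coneEval a (u a) := Finset.sum_congr rfl fun a ha => by
      rw [Function.update_of_ne (ne_of_mem_of_not_mem ha hb)]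
    refine ⟨Function.update u b (r • (t : E), r), fun a ha => ?_, fun h hh => ?_, ?_⟩
    · rcases Finset.mem_insert.1 ha with rfl | ha
      · rw [Function.update_self]
        exact smul_mem_coneOver hr t.2
      · rw [Function.update_of_ne (ne_of_mem_of_not_mem ha hb)]
        exact hu a ha
    · rw [Finset.sum_insert hb, Function.update_self, hupd, hu₁ h hh, coneEval_smul, ← ht h hh,
        integral_add_compl hB (integrable_continuousMap σ h)]
    · rw [Finset.sum_insert hb, Function.update_self, hupd', hu₂, coneEval_smul, ← ht b hbA,
        ← setIntegral_congr_fun hB (fun x (hx : f x = b x) => hx),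
        integral_add_compl hB (integrable_continuousMap σ f)]

variable [IsTopologicalAddGroup E] [ContinuousSMul ℝ E] [LocallyConvexSpace ℝ E] [T2Space E]

/-- If `f` is piecewise one of finitely many affine functions `a`, `g` is piecewise one of finitely
many affine functions `b`, and every `a` is below every `b`, then the integrals of `f` and `g`
compare for any two measures with the same barycenter.  Refining the two partitions in the cone,
each common piece contributes its value under some `a` to the first integral and its value under
some `b` to the second. -/
theorem integral_le_integral_of_piecewise (hΔ : IsChoquetSimplex Δ) [CompactSpace Δ]
    {t : Δ} {μ ν : Measure Δ} (hν : Represents ν t) (hμ : Represents μ t) {f g : C(Δ, ℝ)}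
    (s s' : Finset C(Δ, ℝ)) (hs : ∀ a ∈ s, a ∈ affineFunctions Δ)
    (hs' : ∀ b ∈ s', b ∈ affineFunctions Δ) (hf : ∀ x, ∃ a ∈ s, f x = a x)
    (hg : ∀ x, ∃ b ∈ s', g x = b x) (hab : ∀ a ∈ s, ∀ b ∈ s', ∀ x, a x ≤ b x) :
    ∫ x, f x ∂ν ≤ ∫ x, g x ∂μ := by
  have := hν.isProbabilityMeasure
  have := hμ.isProbabilityMeasure
  have hne : Δ.Nonempty := ⟨t, t.2⟩
  have hc := hΔ.convex
  obtain ⟨u, hu, hu₁, hu₂⟩ := exists_cone_partition hc hne f s hs ν (.of_forall hf)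
  obtain ⟨v, hv, hv₁, hv₂⟩ := exists_cone_partition hc hne g s' hs' μ (.of_forall hg)
  have hsum : ∑ a ∈ s, u a = ∑ b ∈ s', v b := by
    refine eq_of_forall_coneEval (sum_mem_coneOver hc hne s hu) (sum_mem_coneOver hc hne s' hv)
      fun h hh => ?_
    rw [coneEval_sum hc hne hh s hu, coneEval_sum hc hne hh s' hv, hu₁ h hh, hv₁ h hh,
      hν.integral_eq h hh, hμ.integral_eq h hh]
  obtain ⟨z, hz, hz₁, hz₂⟩ := exists_refinement hΔ hne s s' u v hu hv hsum
  calc ∫ x, f x ∂ν = ∑ a ∈ s, coneEval a (u a) := hu₂.symm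
    _ = ∑ a ∈ s, ∑ b ∈ s', coneEval a (z a b) := Finset.sum_congr rfl fun a ha => by
      rw [hz₁ a ha, coneEval_sum hc hne (hs a ha) s' (hz a ha)]
    _ ≤ ∑ a ∈ s, ∑ b ∈ s', coneEval b (z a b) := Finset.sum_le_sum fun a ha =>
      Finset.sum_le_sum fun b hb => coneEval_mono (hab a ha b hb) (hz a ha b hb)
    _ = ∑ b ∈ s', ∑ a ∈ s, coneEval b (z a b) := Finset.sum_comm
    _ = ∑ b ∈ s', coneEval b (v b) := Finset.sum_congr rfl fun b hb => by
      rw [hz₂ b hb, coneEval_sum hc hne (hs' b hb) s fun a ha => hz a ha b hb]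
    _ = ∫ x, g x ∂μ := hv₂

/-- A measure on the extreme points does not distinguish `f` from its upper envelope: `f` is
approximated from above, in the mean, by minima of finitely many affine functions. -/
theorem exists_finset_affine_ge [CompactSpace Δ] [SecondCountableTopology Δ] (hc : Convex ℝ Δ)
    (μ : Measure Δ) [IsProbabilityMeasure μ] (hμ : μ (extremeSet Δ)ᶜ = 0) (f : C(Δ, ℝ))
    {ε : ℝ} (hε : 0 < ε) :
    ∃ (s : Finset C(Δ, ℝ)) (g : C(Δ, ℝ)), (∀ b ∈ s, b ∈ affineFunctions Δ) ∧
      (∀ x, ∃ b ∈ s, g x = b x) ∧ (∀ b ∈ s, ∀ x, f x ≤ b x) ∧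
      ∫ x, g x ∂μ ≤ ∫ x, f x ∂μ + ε := by
  classical
  set C : ℝ := 2 * ‖f‖ + 1
  have hC : 0 < C := by positivity
  obtain ⟨K, hKs, hK, hKlt⟩ := exists_isCompact_subset_extremeSet hc μ hμ
    (ε := ε / 2 / C) (by positivity)
  have hex : ∀ x : Δ, ∃ h ∈ affineFunctions Δ, (∀ y, f y ≤ h y) ∧
      (x ∈ K → h x < f x + ε / 2) := fun x => by
    by_cases hx : x ∈ K
    · obtain ⟨h, hh, hle, hlt⟩ :=
        exists_affine_ge_lt_of_mem_extremeSet hc (hKs hx) f (half_pos hε)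
      exact ⟨h, hh, hle, fun _ => hlt⟩
    · exact ⟨ContinuousMap.const Δ ‖f‖, const_mem_of_one_mem one_mem_affineFunctions _,
        fun y => (le_abs_self _).trans (f.norm_coe_le_norm y), fun h => absurd h hx⟩
  choose h hh hle hlt using hex
  obtain ⟨c, -, hcov⟩ := hK.elim_nhds_subcover (fun x => {y | h x y < f y + ε / 2}) fun x hx =>
    (isOpen_lt (h x).continuous (by fun_prop)).mem_nhds (hlt x hx)
  let s : Finset C(Δ, ℝ) := insert (ContinuousMap.const Δ ‖f‖) (c.image h)
  have hsne : s.Nonempty := Finset.insert_nonempty _ _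
  have hfs : ∀ b ∈ s, ∀ x, f x ≤ b x := fun b hb x => by
    rcases Finset.mem_insert.1 hb with rfl | hb
    · exact (le_abs_self _).trans (f.norm_coe_le_norm x)
    · obtain ⟨y, -, rfl⟩ := Finset.mem_image.1 hb
      exact hle y x
  let g : C(Δ, ℝ) := s.inf' hsne id
  have hgx : ∀ x, g x = s.inf' hsne fun b => b x := fun x => by
    simp only [g, ContinuousMap.inf'_apply, id]
  refine ⟨s, g, fun b hb => ?_, fun x => ?_, hfs, ?_⟩
  · rcases Finset.mem_insert.1 hb with rfl | hb
    · exact const_mem_of_one_mem one_mem_affineFunctions _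
    · obtain ⟨y, -, rfl⟩ := Finset.mem_image.1 hb
      exact hh y
  · obtain ⟨b, hb, hbx⟩ := Finset.exists_mem_eq_inf' hsne fun b : C(Δ, ℝ) => b x
    exact ⟨b, hb, by rw [hgx, hbx]⟩
  · -- `g ≤ f + ε / 2` on `K`, and `g ≤ ‖f‖ ≤ f + C` everywhere.
    have hpt : ∀ x, g x ≤ f x + (ε / 2 + Kᶜ.indicator (fun _ => C) x) := fun x => by
      rw [hgx]
      by_cases hx : x ∈ K
      · obtain ⟨y, hy, hyx⟩ := Set.mem_iUnion₂.1 (hcov hx)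
        have h1 := Finset.inf'_le (fun b : C(Δ, ℝ) => b x)
          (Finset.mem_insert_of_mem (Finset.mem_image_of_mem h hy) : h y ∈ s)
        have h2 : h y x < f x + ε / 2 := hyx
        simp only [Set.indicator_of_notMem (Set.notMem_compl_iff.2 hx)]
        linarith
      · have h1 := Finset.inf'_le (fun b : C(Δ, ℝ) => b x)
          (Finset.mem_insert_self _ _ : ContinuousMap.const Δ ‖f‖ ∈ s)
        have h2 := neg_le_of_abs_le (f.norm_coe_le_norm x)
        rw [Set.indicator_of_mem (Set.mem_compl hx)]
        simp only [ContinuousMap.const_apply] at h1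
        simp only [C]
        linarith
    have hKc : MeasurableSet Kᶜ := hK.isClosed.measurableSet.compl
    have hi : Integrable (Kᶜ.indicator fun _ : Δ => C) μ := (integrable_const C).indicator hKc
    have hi' : Integrable (fun x => ε / 2 + Kᶜ.indicator (fun _ : Δ => C) x) μ :=
      (integrable_const _).add hi
    calc ∫ x, g x ∂μ ≤ ∫ x, (f x + (ε / 2 + Kᶜ.indicator (fun _ => C) x)) ∂μ :=
          integral_mono (integrable_continuousMap μ g)
            ((integrable_continuousMap μ f).add hi') hpt
      _ = ∫ x, f x ∂μ + (ε / 2 + μ.real Kᶜ * C) := by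
        rw [integral_add (integrable_continuousMap μ f) hi', integral_add (integrable_const _) hi,
          integral_indicator_const _ hKc]
        simp
      _ ≤ ∫ x, f x ∂μ + ε := by
        have := (lt_div_iff₀ hC).1 hKlt
        linarith

/-- The maxima of finitely many continuous affine functions: `f` dominates the members of a finite
set of affine functions and agrees with one of them at each point. -/
def maxAffine (Δ : Set E) : Set C(Δ, ℝ) :=
  {f | ∃ s : Finset C(Δ, ℝ), (∀ a ∈ s, a ∈ affineFunctions Δ) ∧ (∀ a ∈ s, ∀ x, a x ≤ f x) ∧
    ∀ x, ∃ a ∈ s, f x = a x}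

omit [MeasurableSpace E] [BorelSpace E] [IsTopologicalAddGroup E] [ContinuousSMul ℝ E]
  [LocallyConvexSpace ℝ E] [T2Space E] in
theorem mem_maxAffine_of_mem {h : C(Δ, ℝ)} (hh : h ∈ affineFunctions Δ) : h ∈ maxAffine Δ :=
  ⟨{h}, by simpa using hh, by simp, by simp⟩

omit [MeasurableSpace E] [BorelSpace E] [IsTopologicalAddGroup E] [ContinuousSMul ℝ E]
  [LocallyConvexSpace ℝ E] [T2Space E] in
theorem add_mem_maxAffine {f g : C(Δ, ℝ)} (hf : f ∈ maxAffine Δ) (hg : g ∈ maxAffine Δ) :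
    f + g ∈ maxAffine Δ := by
  classical
  obtain ⟨s, hs, hs₁, hs₂⟩ := hf
  obtain ⟨s', hs', hs₁', hs₂'⟩ := hg
  refine ⟨Finset.image₂ (· + ·) s s', fun a ha => ?_, fun a ha x => ?_, fun x => ?_⟩
  · obtain ⟨b, hb, c, hc, rfl⟩ := Finset.mem_image₂.1 ha
    exact Submodule.add_mem _ (hs b hb) (hs' c hc)
  · obtain ⟨b, hb, c, hc, rfl⟩ := Finset.mem_image₂.1 ha
    exact add_le_add (hs₁ b hb x) (hs₁' c hc x)
  · obtain ⟨b, hb, hbx⟩ := hs₂ x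
    obtain ⟨c, hc, hcx⟩ := hs₂' x
    exact ⟨b + c, Finset.mem_image₂_of_mem hb hc, by simp [hbx, hcx]⟩

omit [MeasurableSpace E] [BorelSpace E] [IsTopologicalAddGroup E] [ContinuousSMul ℝ E]
  [LocallyConvexSpace ℝ E] [T2Space E] in
theorem sup_mem_maxAffine {f g : C(Δ, ℝ)} (hf : f ∈ maxAffine Δ) (hg : g ∈ maxAffine Δ) :
    f ⊔ g ∈ maxAffine Δ := by
  classical
  obtain ⟨s, hs, hs₁, hs₂⟩ := hf
  obtain ⟨s', hs', hs₁', hs₂'⟩ := hg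
  refine ⟨s ∪ s', fun a ha => ?_, fun a ha x => ?_, fun x => ?_⟩
  · rcases Finset.mem_union.1 ha with ha | ha
    exacts [hs a ha, hs' a ha]
  · rcases Finset.mem_union.1 ha with ha | ha
    exacts [(hs₁ a ha x).trans le_sup_left, (hs₁' a ha x).trans le_sup_right]
  · rcases le_total (f x) (g x) with hle | hle
    · obtain ⟨c, hc, hcx⟩ := hs₂' x
      exact ⟨c, Finset.mem_union_right _ hc, (sup_eq_right.2 hle).trans hcx⟩
    · obtain ⟨c, hc, hcx⟩ := hs₂ x
      exact ⟨c, Finset.mem_union_left _ hc, (sup_eq_left.2 hle).trans hcx⟩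

omit [MeasurableSpace E] [BorelSpace E] in
/-- Differences of maxima of affine functions form a vector lattice that separates points, so they
are dense by the Stone–Weierstrass theorem. -/
theorem closure_sub_maxAffine [CompactSpace Δ] :
    closure {f : C(Δ, ℝ) | ∃ p ∈ maxAffine Δ, ∃ q ∈ maxAffine Δ, f = p - q} = ⊤ := by
  refine ContinuousMap.sublattice_closure_eq_top _ ?_ ?_ ?_ ?_
  · exact ⟨0, 0, mem_maxAffine_of_mem (Submodule.zero_mem _), 0,
      mem_maxAffine_of_mem (Submodule.zero_mem _), by simp⟩
  · rintro _ ⟨p, hp, q, hq, rfl⟩ _ ⟨p', hp', q', hq', rfl⟩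
    refine ⟨p + p', add_mem_maxAffine hp hp', (p + q') ⊔ (p' + q),
      sup_mem_maxAffine (add_mem_maxAffine hp hq') (add_mem_maxAffine hp' hq), ?_⟩
    ext x
    simp only [ContinuousMap.inf_apply, ContinuousMap.sub_apply, ContinuousMap.add_apply,
      ContinuousMap.sup_apply]
    grind
  · rintro _ ⟨p, hp, q, hq, rfl⟩ _ ⟨p', hp', q', hq', rfl⟩
    refine ⟨(p + q') ⊔ (p' + q), sup_mem_maxAffine (add_mem_maxAffine hp hq')
      (add_mem_maxAffine hp' hq), q + q', add_mem_maxAffine hq hq', ?_⟩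
    ext x
    simp only [ContinuousMap.sub_apply, ContinuousMap.add_apply, ContinuousMap.sup_apply]
    grind
  · intro v x y
    suffices H : ∃ h ∈ affineFunctions Δ, h x = v x ∧ h y = v y by
      obtain ⟨h, hh, h'⟩ := H
      exact ⟨h, ⟨h, mem_maxAffine_of_mem hh, 0, mem_maxAffine_of_mem (Submodule.zero_mem _),
        by simp⟩, h'⟩
    have hconst := fun c : ℝ => const_mem_of_one_mem (one_mem_affineFunctions (Δ := Δ)) c
    rcases eq_or_ne x y with rfl | hxy
    · exact ⟨_, hconst (v x), rfl, rfl⟩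
    · obtain ⟨h, hh, hne⟩ : ∃ h ∈ affineFunctions Δ, h x ≠ h y := by
        by_contra! hall
        exact hxy (eq_of_forall_affineFunctions hall)
      have hne' := sub_ne_zero.2 hne.symm
      refine ⟨ContinuousMap.const Δ (v x) + ((v y - v x) / (h y - h x)) •
        (h - ContinuousMap.const Δ (h x)), Submodule.add_mem _ (hconst _)
        (Submodule.smul_mem _ _ (Submodule.sub_mem _ hh (hconst _))), by simp, ?_⟩
      simp [div_mul_cancel₀ _ hne']

/-- In a Choquet simplex a point has at most one representing measure on the extreme points. -/
theorem Represents.eq_of_extremeSet (hΔ : IsChoquetSimplex Δ) [CompactSpace Δ]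
    [SecondCountableTopology Δ] {t : Δ} {μ ν : Measure Δ} (hμ : Represents μ t)
    (hν : Represents ν t) (hμ0 : μ (extremeSet Δ)ᶜ = 0) (hν0 : ν (extremeSet Δ)ᶜ = 0) :
    μ = ν := by
  have := hν.isProbabilityMeasure
  have := hμ.isProbabilityMeasure
  have hle : ∀ {μ ν : Measure Δ}, Represents μ t → Represents ν t → μ (extremeSet Δ)ᶜ = 0 →
      ∀ f ∈ maxAffine Δ, ∫ x, f x ∂ν ≤ ∫ x, f x ∂μ := by
    intro μ ν hμ hν hμ0 f hf
    have := hμ.isProbabilityMeasure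
    obtain ⟨s, hs, hs₁, hs₂⟩ := hf
    refine le_of_forall_pos_le_add fun ε hε => ?_
    obtain ⟨s', g, hs', hg, hfs', hint⟩ := exists_finset_affine_ge hΔ.convex μ hμ0 f hε
    exact (integral_le_integral_of_piecewise hΔ hν hμ s s' hs hs' hs₂ hg
      fun a ha b hb x => (hs₁ a ha x).trans (hfs' b hb x)).trans hint
  have hmax : ∀ f ∈ maxAffine Δ, ∫ x, f x ∂μ = ∫ x, f x ∂ν := fun f hf =>
    le_antisymm (hle hν hμ hν0 f hf) (hle hμ hν hμ0 f hf)
  have hbound : ∀ (σ : Measure Δ) [IsProbabilityMeasure σ] (f g : C(Δ, ℝ)),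
      |∫ x, f x ∂σ - ∫ x, g x ∂σ| ≤ dist f g := fun σ _ f g => by
    rw [← integral_sub (integrable_continuousMap σ f) (integrable_continuousMap σ g)]
    have := norm_integral_le_of_norm_le_const (μ := σ) (f := fun x => f x - g x) (C := dist f g)
      (.of_forall fun x => by
        rw [← dist_eq_norm]
        exact ContinuousMap.dist_apply_le_dist x)
    simpa using this
  have hall : ∀ f : C(Δ, ℝ), ∫ x, f x ∂μ = ∫ x, f x ∂ν := fun f => by
    refine eq_of_abs_sub_le_all fun ε hε => ?_
    have hf : f ∈ closure {f : C(Δ, ℝ) | ∃ p ∈ maxAffine Δ, ∃ q ∈ maxAffine Δ, f = p - q} := by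
      rw [closure_sub_maxAffine]
      trivial
    obtain ⟨_, ⟨p, hp, q, hq, rfl⟩, hd⟩ := Metric.mem_closure_iff.1 hf (ε / 2) (half_pos hε)
    have hpq : ∫ x, (p - q) x ∂μ = ∫ x, (p - q) x ∂ν := by
      simp only [ContinuousMap.sub_apply]
      rw [integral_sub (integrable_continuousMap μ p) (integrable_continuousMap μ q),
        integral_sub (integrable_continuousMap ν p) (integrable_continuousMap ν q),
        hmax p hp, hmax q hq]
    have h1 := abs_le.1 (hbound μ f (p - q))
    have h2 := abs_le.1 (hbound ν f (p - q))
    rw [abs_le]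
    constructor <;> linarith [h1.1, h1.2, h2.1, h2.2]
  exact ext_of_forall_integral_eq_of_IsFiniteMeasure fun f => hall f.toContinuousMap

end Uniqueness

/-! ### Boundary measures -/

section Boundary

variable {E : Type*} [AddCommGroup E] [Module ℝ E] [TopologicalSpace E]
  [IsTopologicalAddGroup E] [ContinuousSMul ℝ E] [LocallyConvexSpace ℝ E] [T2Space E]
  [MeasurableSpace E] [BorelSpace E] {Δ : Set E}

omit [IsTopologicalAddGroup E] [ContinuousSMul ℝ E] [LocallyConvexSpace ℝ E] in
/-- Boundary measures on the ambient space are the images of representing measures on `Δ` that are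
concentrated on the extreme points. -/
theorem isBoundaryMeasure_iff [CompactSpace Δ] (hc : Convex ℝ Δ) (t : Δ) (μ : Measure E) :
    IsBoundaryMeasure Δ t μ ↔
      ∃ ν : Measure Δ, Represents ν t ∧ ν (extremeSet Δ)ᶜ = 0 ∧ μ = ν.map Subtype.val := by
  have hm : MeasurableSet Δ := (isCompact_iff_compactSpace.2 ‹_›).isClosed.measurableSet
  have hemb : MeasurableEmbedding (Subtype.val : Δ → E) := MeasurableEmbedding.subtype_coe hm
  constructor
  · intro h
    have := h.isProbabilityMeasure
    have hμΔ : μ Δᶜ = 0 := measure_mono_null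
      (Set.compl_subset_compl.2 extremePoints_subset) h.concentrated
    have hmap : (μ.comap Subtype.val).map (Subtype.val : Δ → E) = μ := by
      rw [hemb.map_comap, Subtype.range_val]
      exact Measure.restrict_eq_self_of_ae_mem (measure_eq_zero_iff_ae_notMem.1 hμΔ |>.mono
        fun x hx => not_not.1 hx)
    refine ⟨μ.comap Subtype.val, ⟨⟨?_⟩, fun f hf => ?_⟩, ?_, hmap.symm⟩
    · rw [← Set.preimage_univ (f := (Subtype.val : Δ → E)), ← hemb.map_apply, hmap, measure_univ]
    · have h1 := h.barycenter _ (isAffOn_extend hc hf)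
      rw [← hmap, hemb.integral_map, Subtype.val_injective.extend_apply] at h1
      simpa only [Subtype.val_injective.extend_apply] using h1
    · change (μ.comap Subtype.val) (Subtype.val ⁻¹' (Δ.extremePoints ℝ)ᶜ) = 0
      rw [← hemb.map_apply, hmap, h.concentrated]
  · rintro ⟨ν, hν, hν0, rfl⟩
    have := hν.isProbabilityMeasure
    refine ⟨Measure.isProbabilityMeasure_map (by fun_prop), ?_, fun f hf => ?_⟩
    · rw [hemb.map_apply]
      exact hν0
    · rw [hemb.integral_map]
      exact hν.integral_eq ⟨fun x => f x, continuousOn_iff_continuous_domRestrict.1 hf.continuousOn⟩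
        fun x y z a b ha hb hab hz => by
          change f z = a * f x + b * f y
          rw [hz, hf.map_combo x x.2 y y.2 a b ha hb hab]

variable (hΔ : IsChoquetSimplex Δ) [CompactSpace Δ] [SecondCountableTopology Δ]

include hΔ

theorem isBoundaryMeasure_boundaryMeasure (t : Δ) :
    IsBoundaryMeasure Δ t (boundaryMeasure Δ (t : E)) := by
  obtain ⟨ν, hν, hν0⟩ := exists_represents_extremeSet hΔ.convex t
  have h : ∃ μ : Measure E, IsBoundaryMeasure Δ t μ :=
    ⟨_, (isBoundaryMeasure_iff hΔ.convex t _).2 ⟨ν, hν, hν0, rfl⟩⟩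
  rw [boundaryMeasure, dif_pos h]
  exact h.choose_spec

theorem isBoundaryMeasure_iff_eq_boundaryMeasure (t : Δ) (μ : Measure E) :
    IsBoundaryMeasure Δ t μ ↔ μ = boundaryMeasure Δ (t : E) := by
  refine ⟨fun h => ?_, fun h => h ▸ isBoundaryMeasure_boundaryMeasure hΔ t⟩
  obtain ⟨ν, hν, hν0, rfl⟩ := (isBoundaryMeasure_iff hΔ.convex t μ).1 h
  obtain ⟨ν', hν', hν0', heq⟩ := (isBoundaryMeasure_iff hΔ.convex t _).1
    (isBoundaryMeasure_boundaryMeasure hΔ t)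
  rw [heq, hν.eq_of_extremeSet hΔ hν' hν0 hν0']

/-- The boundary measure, seen as a measure on `Δ`. -/
theorem exists_boundaryMeasure_apply (t : Δ) :
    ∃ ν : Measure Δ, Represents ν t ∧ ν (extremeSet Δ)ᶜ = 0 ∧
      ∀ s, boundaryMeasure Δ (t : E) s = ν (Subtype.val ⁻¹' s) := by
  obtain ⟨ν, hν, hν0, heq⟩ := (isBoundaryMeasure_iff hΔ.convex t _).1
    (isBoundaryMeasure_boundaryMeasure hΔ t)
  have hm : MeasurableSet Δ := hΔ.isCompact.isClosed.measurableSet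
  exact ⟨ν, hν, hν0, fun s => by rw [heq, (MeasurableEmbedding.subtype_coe hm).map_apply]⟩

/-- The closed convex hull of a compact set `K` of extreme points consists of the points whose
boundary measure is concentrated on `K`. -/
theorem closure_convexHull_eq_concentratedPoints {K : Set E} (hKe : K ⊆ Δ.extremePoints ℝ)
    (hK : IsCompact K) : closure (convexHull ℝ K) = concentratedPoints Δ K := by
  have hKΔ : K ⊆ Δ := hKe.trans extremePoints_subset
  have hval : Subtype.val '' (Subtype.val ⁻¹' K : Set Δ) = K := by
    rw [Subtype.image_preimage_coe, Set.inter_eq_right.2 hKΔ]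
  ext t
  constructor
  · intro ht
    have htΔ : t ∈ Δ :=
      closure_minimal (convexHull_min hKΔ hΔ.convex) hΔ.isCompact.isClosed ht
    obtain ⟨ν, hν, hν0⟩ := exists_represents_of_mem_closure_convexHull (t := ⟨t, htΔ⟩) hΔ.convex
      (hK.isClosed.preimage continuous_subtype_val) (by rwa [hval])
    have hext : ν (extremeSet Δ)ᶜ = 0 :=
      measure_mono_null (Set.compl_subset_compl.2 fun x hx => hKe hx) hν0
    have heq := (isBoundaryMeasure_iff_eq_boundaryMeasure hΔ ⟨t, htΔ⟩ _).1
      ((isBoundaryMeasure_iff hΔ.convex _ _).2 ⟨ν, hν, hext, rfl⟩)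
    refine ⟨htΔ, ?_⟩
    rw [← heq, (MeasurableEmbedding.subtype_coe hΔ.isCompact.isClosed.measurableSet).map_apply]
    exact measure_mono_null (fun x hx => hx.2) hν0
  · rintro ⟨htΔ, h0⟩
    obtain ⟨ν, hν, hν0, hap⟩ := exists_boundaryMeasure_apply hΔ ⟨t, htΔ⟩
    rw [hap] at h0
    have := hν.mem_closure_convexHull (K := Subtype.val ⁻¹' K) (by
      refine measure_mono_null (fun x hx => ?_) (measure_union_null h0 hν0)
      by_cases h : x ∈ extremeSet Δ
      exacts [Or.inl ⟨h, hx⟩, Or.inr h])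
    rwa [hval] at this

/-! ### Tightness and σ-compactness -/

theorem boundaryMeasure_real_eq_one {K : Set E} (hKe : K ⊆ Δ.extremePoints ℝ)
    (hK : IsCompact K) {t : E} (ht : t ∈ closure (convexHull ℝ K)) :
    (boundaryMeasure Δ t).real K = 1 := by
  rw [closure_convexHull_eq_concentratedPoints hΔ hKe hK] at ht
  obtain ⟨htΔ, h0⟩ := ht
  have hb := isBoundaryMeasure_boundaryMeasure hΔ ⟨t, htΔ⟩
  have := hb.isProbabilityMeasure
  have hc : boundaryMeasure Δ t Kᶜ = 0 := by
    refine measure_mono_null (fun x hx => ?_) (measure_union_null h0 hb.concentrated)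
    by_cases h : x ∈ Δ.extremePoints ℝ
    exacts [Or.inl ⟨h, hx⟩, Or.inr h]
  rw [Measure.real, (prob_compl_eq_zero_iff hK.isClosed.measurableSet).1 hc, ENNReal.toReal_one]

theorem exists_isCompact_lt_boundaryMeasure_real {t : E} (ht : t ∈ Δ) {ε : ℝ} (hε : 0 < ε) :
    ∃ K ⊆ Δ.extremePoints ℝ, IsCompact K ∧ 1 - ε < (boundaryMeasure Δ t).real K := by
  obtain ⟨ν, hν, hν0, hap⟩ := exists_boundaryMeasure_apply hΔ ⟨t, ht⟩
  have := hν.isProbabilityMeasure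
  obtain ⟨K, hKe, hK, hlt⟩ := exists_isCompact_subset_extremeSet hΔ.convex ν hν0 hε
  refine ⟨Subtype.val '' K, Set.image_subset_iff.2 hKe, hK.image continuous_subtype_val, ?_⟩
  rw [Measure.real, hap, Set.preimage_image_eq _ Subtype.val_injective, ← Measure.real]
  rw [probReal_compl_eq_one_sub hK.isClosed.measurableSet] at hlt
  linarith

omit [IsTopologicalAddGroup E] [ContinuousSMul ℝ E] [LocallyConvexSpace ℝ E]
  [MeasurableSpace E] [BorelSpace E] [CompactSpace Δ] [SecondCountableTopology Δ] in
theorem closure_extremePoints_subset : closure (Δ.extremePoints ℝ) ⊆ Δ :=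
  closure_minimal extremePoints_subset hΔ.isCompact.isClosed

theorem hasTightBoundary_of_finite_diff {K : Set E} (hKe : K ⊆ Δ.extremePoints ℝ)
    (hK : IsCompact K) (hfin : (bdExtreme Δ \ closure (convexHull ℝ K)).Finite) :
    HasTightBoundary Δ := by
  intro ε hε
  have hbd : bdExtreme Δ ⊆ Δ := Set.sdiff_subset.trans (closure_extremePoints_subset hΔ)
  have hex : ∀ t : E, ∃ L ⊆ Δ.extremePoints ℝ, IsCompact L ∧
      (t ∈ Δ → 1 - ε < (boundaryMeasure Δ t).real L) := fun t => by
    by_cases ht : t ∈ Δ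
    · obtain ⟨L, h1, h2, h3⟩ := exists_isCompact_lt_boundaryMeasure_real hΔ ht hε
      exact ⟨L, h1, h2, fun _ => h3⟩
    · exact ⟨∅, Set.empty_subset _, isCompact_empty, fun h => absurd h ht⟩
  choose L hLe hL hlt using hex
  refine ⟨K ∪ ⋃ t ∈ bdExtreme Δ \ closure (convexHull ℝ K), L t,
    Set.union_subset hKe (Set.iUnion₂_subset fun t _ => hLe t),
    hK.union (hfin.isCompact_biUnion fun t _ => hL t), fun t ht => ?_⟩
  have := (isBoundaryMeasure_boundaryMeasure hΔ ⟨t, hbd ht⟩).isProbabilityMeasure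
  by_cases htK : t ∈ closure (convexHull ℝ K)
  · calc 1 - ε < 1 := by linarith
      _ = (boundaryMeasure Δ t).real K := (boundaryMeasure_real_eq_one hΔ hKe hK htK).symm
      _ ≤ _ := measureReal_mono Set.subset_union_left (measure_ne_top _ _)
  · refine (hlt t (hbd ht)).trans_le (measureReal_mono ?_ (measure_ne_top _ _))
    exact (Set.subset_biUnion_of_mem (u := L)
      (show t ∈ bdExtreme Δ \ closure (convexHull ℝ K) from ⟨ht, htK⟩)).trans Set.subset_union_right

/-- Milman's partial converse of the Krein–Milman theorem. -/
theorem mem_of_mem_closure_convexHull {K : Set E} (hKe : K ⊆ Δ.extremePoints ℝ)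
    (hK : IsCompact K) {t : E} (hte : t ∈ Δ.extremePoints ℝ)
    (ht : t ∈ closure (convexHull ℝ K)) : t ∈ K := by
  have htΔ : t ∈ Δ := extremePoints_subset hte
  obtain ⟨ν, hν, hν0, hap⟩ := exists_boundaryMeasure_apply hΔ ⟨t, htΔ⟩
  have h1 := boundaryMeasure_real_eq_one hΔ hKe hK ht
  by_contra htK
  have : ν (Subtype.val ⁻¹' K) = 0 := by
    refine measure_mono_null (fun x hx => ?_) (hν.compl_singleton_null hΔ.convex hte)
    rintro rfl
    exact htK hx
  rw [Measure.real, hap, this] at h1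
  simp at h1

/-- A point whose boundary measure gives mass at least `1 / 2` to `K` is the midpoint of a point of
the closed convex hull of `K` and a point of `Δ`. -/
theorem exists_midpoint_of_le_boundaryMeasure {K : Set E} (hKe : K ⊆ Δ.extremePoints ℝ)
    (hK : IsCompact K) {t : E} (ht : t ∈ Δ) (hle : 1 / 2 ≤ (boundaryMeasure Δ t).real K) :
    ∃ k ∈ closure (convexHull ℝ K), ∃ r ∈ Δ, t = (1 / 2 : ℝ) • k + (1 / 2 : ℝ) • r := by
  obtain ⟨ν, hν, hν0, hap⟩ := exists_boundaryMeasure_apply hΔ ⟨t, ht⟩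
  have := hν.isProbabilityMeasure
  set B : Set Δ := Subtype.val ⁻¹' K
  have hB : MeasurableSet B := (hK.isClosed.preimage continuous_subtype_val).measurableSet
  rw [Measure.real, hap, ← Measure.real] at hle
  obtain ⟨u, v, huv, hu⟩ := hν.exists_split hΔ.convex hB
  set m := ν.real B with hm
  have hm0 : 0 < m := by linarith
  have hm1 : m ≤ 1 := measureReal_le_one
  have hBpos : ν B ≠ 0 := fun h => hm0.ne' (by rw [hm, Measure.real, h, ENNReal.toReal_zero])
  have hval : Subtype.val '' B = K := by
    rw [Subtype.image_preimage_coe, Set.inter_eq_right.2 (hKe.trans extremePoints_subset)]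
  have hrep : Represents ((ν B)⁻¹ • ν.restrict B) u := by
    refine ⟨⟨?_⟩, fun h hh => ?_⟩
    · simp [ENNReal.inv_mul_cancel hBpos (measure_ne_top ν B)]
    · rw [integral_smul_measure, hu h hh, ENNReal.toReal_inv, smul_eq_mul, ← Measure.real, ← hm,
        inv_mul_cancel_left₀ hm0.ne']
  have huK : (u : E) ∈ closure (convexHull ℝ K) := by
    rw [← hval]
    refine hrep.mem_closure_convexHull ?_
    simp [Measure.restrict_apply hB.compl]
  refine ⟨u, huK, (2 * m - 1) • (u : E) + (2 - 2 * m) • (v : E),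
    hΔ.convex u.2 v.2 (by linarith) (by linarith) (by ring), ?_⟩
  rw [show t = _ from huv]
  module

/-- If `K` carries at least half of the boundary measure of each boundary point, the compact set `S`
of midpoints of the closed convex hull of `K` and `Δ` contains every non-extreme limit of extreme
points, and no extreme point outside `K`; so the extreme points outside `K` form the difference of
two compact sets. -/
theorem isSigmaCompact_extremePoints (htight : HasTightBoundary Δ) :
    IsSigmaCompact (Δ.extremePoints ℝ) := by
  obtain ⟨K, hKe, hK, hlt⟩ := htight (1 / 2) one_half_pos
  have hKΔ : closure (convexHull ℝ K) ⊆ Δ := closure_minimal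
    (convexHull_min (hKe.trans extremePoints_subset) hΔ.convex) hΔ.isCompact.isClosed
  have hcl := closure_extremePoints_subset hΔ
  set S : Set E := (fun p : E × E => (1 / 2 : ℝ) • p.1 + (1 / 2 : ℝ) • p.2) ''
    (closure (convexHull ℝ K) ×ˢ Δ)
  have hS : IsClosed S := (((hΔ.isCompact.of_isClosed_subset isClosed_closure hKΔ).prod
    hΔ.isCompact).image (by fun_prop)).isClosed
  have hbdS : bdExtreme Δ ⊆ S := fun t ht => by
    obtain ⟨k, hk, r, hr, h⟩ := exists_midpoint_of_le_boundaryMeasure hΔ hKe hK (hcl ht.1)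
      (by linarith [hlt t ht])
    exact ⟨(k, r), ⟨hk, hr⟩, h.symm⟩
  have hSK : ∀ t ∈ S, t ∈ Δ.extremePoints ℝ → t ∈ K := by
    rintro _ ⟨⟨k, r⟩, ⟨hk, hr⟩, rfl⟩ hte
    have hkt := ((mem_extremePoints.1 hte).2 k (hKΔ hk) r hr
      ⟨1 / 2, 1 / 2, by norm_num, by norm_num, by norm_num, rfl⟩).1
    refine mem_of_mem_closure_convexHull hΔ hKe hK hte ?_
    rwa [← hkt]
  have := hΔ.metrizable
  let _ := TopologicalSpace.metrizableSpaceMetric Δ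
  obtain ⟨F, hF, hFS, hFU, -⟩ :=
    (hS.preimage (continuous_subtype_val : Continuous (Subtype.val : Δ → E))).isOpen_compl
      |>.exists_iUnion_isClosed
  have heq : Δ.extremePoints ℝ =
      ⋃ n, (K ∪ Subtype.val '' (Subtype.val ⁻¹' closure (Δ.extremePoints ℝ) ∩ F n)) := by
    ext t
    simp only [Set.mem_iUnion]
    constructor
    · intro ht
      by_cases htK : t ∈ K
      · exact ⟨0, Or.inl htK⟩
      · have htF : (⟨t, extremePoints_subset ht⟩ : Δ) ∈ ⋃ n, F n := by
          rw [hFU]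
          exact fun htS => htK (hSK t htS ht)
        obtain ⟨n, hn⟩ := Set.mem_iUnion.1 htF
        exact ⟨n, Or.inr ⟨_, ⟨subset_closure ht, hn⟩, rfl⟩⟩
    · rintro ⟨n, ht | ⟨x, ⟨hx, hxn⟩, rfl⟩⟩
      · exact hKe ht
      · by_contra hne
        exact hFS n hxn (hbdS ⟨hx, hne⟩)
  rw [heq]
  refine isSigmaCompact_iUnion_of_isCompact _ fun n => hK.union ?_
  exact ((isClosed_closure.preimage continuous_subtype_val).inter (hF n)).isCompact.image
    continuous_subtype_val

end Boundary

end ChoquetSimplex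

open ChoquetSimplex in
theorem proposition4p5 {E : Type*} [AddCommGroup E] [Module ℝ E] [TopologicalSpace E]
    [IsTopologicalAddGroup E] [ContinuousSMul ℝ E] [LocallyConvexSpace ℝ E] [T2Space E]
    [MeasurableSpace E] [BorelSpace E] (Δ : Set E) (hΔ : IsChoquetSimplex Δ) :
    -- every point of `Δ` has exactly one boundary measure, and this is `boundaryMeasure Δ t`
    (∀ t ∈ Δ, ∀ μ : Measure E, IsBoundaryMeasure Δ t μ ↔ μ = boundaryMeasure Δ t) ∧
    -- (1)
    (HasTightBoundary Δ → IsSigmaCompact (Δ.extremePoints ℝ)) ∧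
    -- (2)
    (∀ K ⊆ Δ.extremePoints ℝ, IsCompact K →
      closure (convexHull ℝ K) = concentratedPoints Δ K) ∧
    -- (3)
    ((∃ K ⊆ Δ.extremePoints ℝ, IsCompact K ∧
        (bdExtreme Δ \ closure (convexHull ℝ K)).Finite) → HasTightBoundary Δ) ∧
    ((bdExtreme Δ).Finite → HasTightBoundary Δ) ∧
    -- (4)
    (HasT1 Δ → HasTightBoundary Δ) := by
  have : CompactSpace Δ := isCompact_iff_compactSpace.1 hΔ.isCompact
  have : SecondCountableTopology Δ := by
    have := hΔ.metrizable
    let _ := TopologicalSpace.metrizableSpaceMetric Δ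
    infer_instance
  refine ⟨fun t ht μ => isBoundaryMeasure_iff_eq_boundaryMeasure hΔ ⟨t, ht⟩ μ,
    isSigmaCompact_extremePoints hΔ,
    fun K hKe hK => closure_convexHull_eq_concentratedPoints hΔ hKe hK, ?_, fun h => ?_, ?_⟩
  · rintro ⟨K, hKe, hK, h⟩
    exact hasTightBoundary_of_finite_diff hΔ hKe hK h
  · exact hasTightBoundary_of_finite_diff hΔ (Set.empty_subset _) isCompact_empty
      (h.subset Set.sdiff_subset)
  · rintro ⟨K, hKe, hK, h⟩
    refine hasTightBoundary_of_finite_diff hΔ hKe hK ?_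
    rw [Set.sdiff_eq_empty.2 h]
    exact Set.finite_empty
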